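/- Let $\mu$ be a compactly supported probability measure on $\mathbb{R}$ with $\int x\,d\mu=0$, $\int x^2\,d\mu=\sigma^2$, $\int x^3\,d\mu\neq 0$, and, for some constant $K$, $\int |x|^k\,d\mu\le K^k$ for all $k\ge 4$. For each $N$ let $A_N=N^{-1/2}(a_{ij})_{i,j=1}^N$ be a random real symmetric matrix whose entries $a_{ij}$, $i\le j$, are i.i.d. with law $\mu$. A closed path of length $n$ is a sequence $i_0\to i_1\to\cdots\to i_n=i_0$ of vertices in $\{1,\dots,N\}$; it is called odd if some non-oriented edge (loops included) occurs in it an odd number of times, and even otherwise. Let $Z_e$ (resp. $Z_o$) denote the sum, over all even (resp. odd) closed paths of length $2s_N$, of $\mathbb{E}\prod_{j=0}^{2s_N-1} N^{-1/2}a_{i_j i_{j+1}}$. Let $(s_N)$ be a sequence of natural numbers such that $s_N\to\infty$ and $s_N=o(\sqrt N)$ as $N\to\infty$. Then all the expectations involved are those of integrable random variables and, as $N\to\infty$, $$\mathbb{E}\,\mathrm{Tr}\,A_N^{2s_N}=Z_e\,(1+o(1))=(1+o(1))\,N\,T_{0,2s_N}\,\sigma^{2s_N},\qquad T_{0,2s}=\frac{(2s)!}{s!\,(s+1)!},$$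 where $T_{0,2s}$ is the $s$-th Catalan number. In particular, $Z_e=(1+o(1))\,N\,T_{0,2s_N}\,\sigma^{2s_N}$ and $Z_o=o(Z_e)$. -/

import Mathlib

open MeasureTheory ProbabilityTheory Filter Asymptotics

noncomputable section

namespace WignerTrace

/-- A compactly supported law on the line with mean `0`, variance `σ ^ 2`, nonzero third moment,
and absolute moments of order `k ≥ 4` bounded by `K ^ k` for some constant `K`. -/
structure IsEntryLaw (μ : Measure ℝ) (σ : ℝ) : Prop where
  compact_support : IsCompact μ.support
  mean : ∫ x, x ∂μ = 0
  variance : ∫ x, x ^ 2 ∂μ = σ ^ 2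
  third_moment : ∫ x, x ^ 3 ∂μ ≠ 0
  moment_bound : ∃ K : ℝ, ∀ k : ℕ, 4 ≤ k → ∫ x, |x| ^ k ∂μ ≤ K ^ k

/-- The entries `a i j` form a symmetric array, and those with `i ≤ j` are i.i.d. of law `μ`. -/
structure IsSymmetricIID {N : ℕ} {Ω : Type*} [MeasurableSpace Ω] (P : Measure Ω)
    (μ : Measure ℝ) (a : Fin N → Fin N → Ω → ℝ) : Prop where
  symm : ∀ i j ω, a i j ω = a j i ω
  law : ∀ i j, i ≤ j → HasLaw (a i j) μ P
  indep : iIndepFun (fun (q : {q : Fin N × Fin N // q.1 ≤ q.2}) => a q.1.1 q.1.2) P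

/-- The normalized random matrix `N ^ (-1/2) (a i j)`. -/
def randomMatrix {N : ℕ} {Ω : Type*} (a : Fin N → Fin N → Ω → ℝ) (ω : Ω) :
    Matrix (Fin N) (Fin N) ℝ :=
  (1 / Real.sqrt N) • Matrix.of (fun i j => a i j ω)

/-- Closed paths `i₀ → i₁ → ⋯ → iₙ = i₀` with `n` steps on `N` vertices. -/
abbrev ClosedPath (N n : ℕ) : Type :=
  {p : Fin (n + 1) → Fin N // p (Fin.last n) = p 0}

namespace ClosedPath

variable {N n : ℕ}

/-- The non-oriented edge read at step `j` (possibly a loop). -/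
def edge (p : ClosedPath N n) (j : Fin n) : Sym2 (Fin N) :=
  s(p.1 j.castSucc, p.1 j.succ)

/-- The number of times the non-oriented edge `e` is read. -/
def edgeCount (p : ClosedPath N n) (e : Sym2 (Fin N)) : ℕ :=
  (Finset.univ.filter (fun j => p.edge j = e)).card

/-- An odd path has at least one edge that appears an odd number of times. -/
def IsOdd (p : ClosedPath N n) : Prop :=
  ∃ e, Odd (p.edgeCount e)

/-- An even path has no odd edge. -/
def IsEven (p : ClosedPath N n) : Prop :=
  ∀ e, Even (p.edgeCount e)

/-- The product of matrix entries `∏ⱼ A (iⱼ) (iⱼ₊₁)` along the path. -/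
def entryProd (p : ClosedPath N n) (A : Matrix (Fin N) (Fin N) ℝ) : ℝ :=
  ∏ j : Fin n, A (p.1 j.castSucc) (p.1 j.succ)

end ClosedPath

/-- The expected trace of the `n`-th power. -/
def expectedTrace {N : ℕ} {Ω : Type*} [MeasurableSpace Ω] (P : Measure Ω)
    (a : Fin N → Fin N → Ω → ℝ) (n : ℕ) : ℝ :=
  ∫ ω, (randomMatrix a ω ^ n).trace ∂P

open Classical in
/-- The contribution of the even closed paths of length `n` to the expected trace. -/
def evenContribution {N : ℕ} {Ω : Type*} [MeasurableSpace Ω] (P : Measure Ω)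
    (a : Fin N → Fin N → Ω → ℝ) (n : ℕ) : ℝ :=
  ∑ p : ClosedPath N n with p.IsEven, ∫ ω, p.entryProd (randomMatrix a ω) ∂P

open Classical in
/-- The contribution of the odd closed paths of length `n` to the expected trace. -/
def oddContribution {N : ℕ} {Ω : Type*} [MeasurableSpace Ω] (P : Measure Ω)
    (a : Fin N → Fin N → Ω → ℝ) (n : ℕ) : ℝ :=
  ∑ p : ClosedPath N n with p.IsOdd, ∫ ω, p.entryProd (randomMatrix a ω) ∂P

end WignerTrace

end

/-!
By independence the expectation of the product along a path is a product of moments of `μ`, one for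
each edge. It vanishes if some edge is passed exactly once, and otherwise it is at most
`σ ^ n * R ^ k`, up to the normalization, where `|x| ≤ R * |σ|` almost surely and `k` counts the
passages beyond the second one through each edge.

*Upper bound.* Follow the path and keep the set of open edges, those still to be passed again. A
step opens an edge, closes an open one, or is a transit through an open edge that leaves it open.
Without transits and without edges to visited vertices, the number of open edges performs a
nonnegative `±1` path and every closing step is forced, which gives the Catalan number times `N` for
each of the `s` openings. In general the current vertex offers several open edges. This choice is
paid for by a potential, the number of ways to pair off the open half-edges at each vertex: closing
divides it by at least the number of choices, whereas opening an edge to `w` multiplies it by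
`deg w + 1`, which is `1` on average over `w` up to `O(s / N)`. A transit leaves the number of open
edges unchanged and thereby loses a factor `√N` against the other steps; transits are absorbed by a
charge `1 / γ` per unit of excess, with `γ` lowered by `O(1 / √N)` at each step. The result is
`N * catalan s * σ ^ (2 * s) * (1 + o(1))` for all paths, even and odd.

*Lower bound.* An even path contributes at least `(σ / √N) ^ (2 * s)` by Jensen's inequality. Even
paths abound: keep a self-avoiding list of vertices and at each step either push a new vertex or pop
the last one. This gives `catalan s * (N - 2 * s - 1) ^ s` even paths from each vertex.

The upper bound covers the sum of the even part and the absolute value of the odd part, and the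
lower bound already accounts for the even part, so the odd part is squeezed.
-/

namespace WignerTrace

open scoped Finset Nat

/-! ### Ballot numbers and pairings -/

/-- The number of `±1` paths with `n` steps from height `k` to height `0` that stay nonnegative. -/
def ballot : ℕ → ℕ → ℕ
  | 0, 0 => 1
  | 0, _ + 1 => 0
  | n + 1, 0 => ballot n 1
  | n + 1, k + 1 => ballot n (k + 2) + ballot n k

theorem ballot_add_choose {n k m : ℕ} (h : n + k = 2 * m) :
    ballot n k + n.choose (m + 1) = n.choose m := by
  induction n generalizing k m with
  | zero =>
    obtain rfl | hm := m.eq_zero_or_pos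
    · obtain rfl : k = 0 := by omega
      rfl
    · obtain ⟨k, rfl⟩ : ∃ l, k = l + 1 := ⟨k - 1, by omega⟩
      rw [Nat.choose_eq_zero_of_lt hm, Nat.choose_eq_zero_of_lt (by omega), ballot]
  | succ n ih =>
    obtain ⟨m, rfl⟩ : ∃ l, m = l + 1 := ⟨m - 1, by omega⟩
    rw [Nat.choose_succ_succ', Nat.choose_succ_succ']
    rcases k with _ | k
    · have middle : n.choose m = n.choose (m + 1) := Nat.choose_symm_of_eq_add (by omega)
      have := ih (k := 1) (m := m + 1) (by omega)
      rw [ballot]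
      omega
    · have := ih (k := k + 2) (m := m + 1) (by omega)
      have := ih (k := k) (m := m) (by omega)
      rw [ballot]
      omega

theorem ballot_two_mul_zero (m : ℕ) : ballot (2 * m) 0 = catalan m := by
  have reflection := ballot_add_choose (n := 2 * m) (k := 0) (m := m) rfl
  have ratio := Nat.choose_succ_right_eq (2 * m) m
  rw [show 2 * m - m = m by omega] at ratio
  refine Nat.eq_of_mul_eq_mul_left m.succ_pos ?_
  rw [Nat.succ_eq_add_one, succ_mul_catalan_eq_centralBinom, Nat.centralBinom]
  linarith [congrArg ((m + 1) * ·) reflection]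

theorem ballot_eq_zero_of_odd {n k : ℕ} (h : Odd (n + k)) : ballot n k = 0 := by
  induction n generalizing k with
  | zero =>
    obtain ⟨k, rfl⟩ : ∃ l, k = l + 1 := ⟨k - 1, by grind⟩
    rfl
  | succ n ih =>
    rcases k with _ | k
    · exact ih (by simpa using h)
    · rw [ballot, ih (by grind), ih (by grind)]

theorem ballot_le_ballot_add_two (n k : ℕ) : ballot n k ≤ ballot (n + 2) k := by
  rcases k with _ | k
  · exact Nat.le_add_left _ _
  · simp only [ballot]
    omega

/-- The number of nonnegative `±1` paths from height `k` to height `0` with `n` or `n + 1` steps.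
Parity excludes one of the two lengths, and unlike `ballot` this is monotone in `n`. -/
def paddedBallot (n k : ℕ) : ℕ := ballot n k + ballot (n + 1) k

theorem paddedBallot_succ_succ (n k : ℕ) :
    paddedBallot (n + 1) (k + 1) = paddedBallot n (k + 2) + paddedBallot n k := by
  simp only [paddedBallot, ballot]
  omega

theorem paddedBallot_le_succ (n k : ℕ) : paddedBallot n k ≤ paddedBallot (n + 1) k := by
  rw [paddedBallot, paddedBallot, add_comm]
  exact Nat.add_le_add_left (ballot_le_ballot_add_two n k) _

theorem paddedBallot_succ_le_succ (n k : ℕ) :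
    paddedBallot n (k + 1) ≤ paddedBallot (n + 1) k := by
  rcases k with _ | k
  · rfl
  · rw [paddedBallot_succ_succ]
    exact Nat.le_add_right _ _

theorem paddedBallot_two_mul_zero (m : ℕ) : paddedBallot (2 * m) 0 = catalan m := by
  rw [paddedBallot, ballot_two_mul_zero, ballot_eq_zero_of_odd (n := 2 * m + 1) (by simp), add_zero]

/-- The number `(d - 1)‼` of perfect matchings of `d` half-edges; for odd `d` this is the usual
interpolation, and truncated subtraction gives the value `1` at `d = 0`. -/
def pairingCount (d : ℕ) : ℕ := (d - 1)‼

theorem pairingCount_pos (d : ℕ) : 0 < pairingCount d := Nat.doubleFactorial_pos _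

theorem pairingCount_add_two (d : ℕ) : pairingCount (d + 2) = (d + 1) * pairingCount d := by
  rcases d with _ | d
  · rfl
  · exact Nat.doubleFactorial_add_two d

theorem add_two_mul_doubleFactorial_sq_le (n : ℕ) : (n + 2) * n‼ ^ 2 ≤ 2 * (n + 1)‼ ^ 2 := by
  induction n using Nat.twoStepInduction with
  | zero => rfl
  | one => decide
  | more n ih _ =>
    rw [Nat.doubleFactorial_add_two, Nat.doubleFactorial_add_two (n + 1)]
    calc (n + 2 + 2) * ((n + 2) * n‼) ^ 2
        = (n + 4) * (n + 2) * ((n + 2) * n‼ ^ 2) := by ring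
      _ ≤ (n + 3) ^ 2 * (2 * (n + 1)‼ ^ 2) := Nat.mul_le_mul (by nlinarith) ih
      _ = 2 * ((n + 1 + 2) * (n + 1)‼) ^ 2 := by ring

theorem doubleFactorial_succ_sq_le (n : ℕ) : (n + 1)‼ ^ 2 ≤ 2 * (n + 1) * n‼ ^ 2 := by
  induction n using Nat.twoStepInduction with
  | zero => decide
  | one => decide
  | more n ih _ =>
    rw [Nat.doubleFactorial_add_two, Nat.doubleFactorial_add_two]
    calc ((n + 1 + 2) * (n + 1)‼) ^ 2
        = (n + 3) ^ 2 * (n + 1)‼ ^ 2 := by ring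
      _ ≤ (n + 3) ^ 2 * (2 * (n + 1) * n‼ ^ 2) := by gcongr
      _ = 2 * (n + 3) * ((n + 3) * (n + 1)) * n‼ ^ 2 := by ring
      _ ≤ 2 * (n + 3) * (n + 2) ^ 2 * n‼ ^ 2 := by gcongr; nlinarith
      _ = 2 * (n + 2 + 1) * ((n + 2) * n‼) ^ 2 := by ring

theorem mul_doubleFactorial_mul_le {a b D : ℕ} (ha : a + 1 ≤ D) (hb : b + 1 ≤ D) :
    (a + 1) * (a‼ * (b + 1)‼) ≤ 2 * D * ((a + 1)‼ * b‼) := by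
  refine (Nat.pow_le_pow_iff_left two_ne_zero).mp ?_
  calc ((a + 1) * (a‼ * (b + 1)‼)) ^ 2
      = (a + 1) * ((a + 1) * a‼ ^ 2) * (b + 1)‼ ^ 2 := by ring
    _ ≤ D * (2 * (a + 1)‼ ^ 2) * (2 * D * b‼ ^ 2) :=
        Nat.mul_le_mul
          (Nat.mul_le_mul ha
            ((Nat.mul_le_mul_right _ (by omega)).trans (add_two_mul_doubleFactorial_sq_le a)))
          ((doubleFactorial_succ_sq_le b).trans (by gcongr))
    _ = (2 * D * ((a + 1)‼ * b‼)) ^ 2 := by ring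

theorem mul_pairingCount_mul_le {a b D : ℕ} (ha : a ≤ D) (hb : b ≤ D) :
    a * (pairingCount a * pairingCount (b + 1)) ≤
      2 * D * (pairingCount (a + 1) * pairingCount b) := by
  rcases a with _ | a
  · simp
  rcases b with _ | b
  · exact mul_doubleFactorial_mul_le ha (b := 0) (by omega)
  · exact mul_doubleFactorial_mul_le ha hb

section ProdPairingCount

variable {V : Type*} [Fintype V] [DecidableEq V] (f : V → ℕ)

theorem prod_pairingCount_add_two (w : V) :
    ∏ x, pairingCount (f x + if x = w then 2 else 0) = (f w + 1) * ∏ x, pairingCount (f x) := by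
  rw [← Finset.mul_prod_erase _ _ (Finset.mem_univ w), if_pos rfl, pairingCount_add_two, mul_assoc,
    ← Finset.mul_prod_erase Finset.univ (pairingCount <| f ·) (Finset.mem_univ w)]
  congr 2
  refine Finset.prod_congr rfl fun x hx ↦ ?_
  rw [if_neg (Finset.ne_of_mem_erase hx), add_zero]

theorem prod_pairingCount_add_one_mul (w : V) :
    (∏ x, pairingCount (f x + if x = w then 1 else 0)) * pairingCount (f w) =
      pairingCount (f w + 1) * ∏ x, pairingCount (f x) := by
  rw [← Finset.mul_prod_erase _ _ (Finset.mem_univ w), if_pos rfl, mul_assoc,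
    ← Finset.prod_erase_mul Finset.univ (pairingCount <| f ·) (Finset.mem_univ w)]
  congr 2
  refine Finset.prod_congr rfl fun x hx ↦ ?_
  rw [if_neg (Finset.ne_of_mem_erase hx), add_zero]

theorem mul_prod_pairingCount_add_one_le {D : ℕ} {u w : V} (hu : f u ≤ D) (hw : f w ≤ D) :
    f u * ∏ x, pairingCount (f x + if x = w then 1 else 0) ≤
      2 * D * ∏ x, pairingCount (f x + if x = u then 1 else 0) := by
  refine Nat.le_of_mul_le_mul_right ?_
    (Nat.mul_pos (pairingCount_pos (f u)) (pairingCount_pos (f w)))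
  calc f u * (∏ x, pairingCount (f x + if x = w then 1 else 0)) *
        (pairingCount (f u) * pairingCount (f w))
      = f u * pairingCount (f u) *
        ((∏ x, pairingCount (f x + if x = w then 1 else 0)) * pairingCount (f w)) := by ring
    _ = f u * (pairingCount (f u) * pairingCount (f w + 1)) * ∏ x, pairingCount (f x) := by
        rw [prod_pairingCount_add_one_mul]
        ring
    _ ≤ 2 * D * (pairingCount (f u + 1) * pairingCount (f w)) * ∏ x, pairingCount (f x) := by
        gcongr ?_ * _
        exact mul_pairingCount_mul_le hu hw
    _ = 2 * D * pairingCount (f w) *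
        ((∏ x, pairingCount (f x + if x = u then 1 else 0)) * pairingCount (f u)) := by
        rw [prod_pairingCount_add_one_mul]
        ring
    _ = _ := by ring

end ProdPairingCount

/-! ### Walks in progress -/

section WalkState

variable {V : Type*} [DecidableEq V]

theorem count_toMultiset_mk (x a b : V) :
    s(a, b).toMultiset.count x = (if x = a then 1 else 0) + if x = b then 1 else 0 := by
  change Multiset.count x {a, b} = _
  rw [Multiset.insert_eq_cons, Multiset.count_cons, Multiset.count_singleton, add_comm]

theorem sum_le_of_card_mul_le {ι : Type*} {s : Finset ι} {g : ι → ℕ} {A : ℕ}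
    (h : ∀ i ∈ s, #s * g i ≤ A) : ∑ i ∈ s, g i ≤ A := by
  obtain rfl | hs := s.eq_empty_or_nonempty
  · simp
  · refine Nat.le_of_mul_le_mul_left ?_ hs.card_pos
    rw [Finset.mul_sum]
    exact Finset.sum_le_card_nsmul _ _ _ h

/-- A walk in progress, some of whose edges are *open*: they have to be passed again. Only what
matters for the rest of the walk is recorded. The `excess` charges `1` for each passage through an
open edge that leaves it open, and `2` for each opening of an edge that leads to a visited vertex;
it is by how much the length of the completed walk exceeds that of a walk passing each edge of a
tree twice. -/
structure WalkState (V : Type*) where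
  cur : V
  opened : Finset (Sym2 V)
  visited : Finset V
  excess : ℕ

namespace WalkState

/-- The walk that stands at `v` and has not moved yet. -/
def start (v : V) : WalkState V := ⟨v, ∅, {v}, 0⟩

variable (S : WalkState V)

/-- The step to `w` that opens the edge. -/
def up (w : V) : WalkState V where
  cur := w
  opened := insert s(S.cur, w) S.opened
  visited := insert w S.visited
  excess := S.excess + if w ∈ S.visited then 2 else 0

/-- The step to `w` that closes the edge. -/
def down (w : V) : WalkState V where
  cur := w
  opened := S.opened.erase s(S.cur, w)
  visited := S.visited
  excess := S.excess

/-- The step to `w` through an open edge that leaves it open. -/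
def transit (w : V) : WalkState V where
  cur := w
  opened := S.opened
  visited := S.visited
  excess := S.excess + 1

/-- The number of open half-edges at `x`; an open loop counts twice. -/
def openDegree (x : V) : ℕ := ∑ e ∈ S.opened, e.toMultiset.count x

/-- The number of half-edges at `x` that await a partner, the current position being one. -/
def deg (x : V) : ℕ := S.openDegree x + if x = S.cur then 1 else 0

theorem deg_cur : S.deg S.cur = S.openDegree S.cur + 1 := by rw [deg, if_pos rfl]

theorem deg_start (v x : V) : (start v).deg x = if x = v then 1 else 0 := by
  change ∑ e ∈ ∅, _ + (if x = v then 1 else 0) = _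
  rw [Finset.sum_empty, zero_add]

theorem deg_up {w : V} (h : s(S.cur, w) ∉ S.opened) (x : V) :
    (S.up w).deg x = S.deg x + if x = w then 2 else 0 := by
  change ∑ e ∈ insert s(S.cur, w) S.opened, _ + (if x = w then 1 else 0) = _
  rw [Finset.sum_insert h, count_toMultiset_mk, deg, openDegree]
  split_ifs <;> omega

theorem deg_eq_deg_down_add {w : V} (h : s(S.cur, w) ∈ S.opened) (x : V) :
    S.deg x = (S.down w).deg x + if x = S.cur then 2 else 0 := by
  change _ = ∑ e ∈ S.opened.erase s(S.cur, w), _ + (if x = w then 1 else 0) + _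
  rw [deg, openDegree, ← Finset.add_sum_erase _ _ h, count_toMultiset_mk]
  split_ifs <;> omega

theorem one_le_openDegree {w : V} (h : s(S.cur, w) ∈ S.opened) : 1 ≤ S.openDegree w := by
  refine le_trans ?_ (Finset.single_le_sum (fun e _ ↦ Nat.zero_le (e.toMultiset.count w)) h)
  rw [count_toMultiset_mk, if_pos rfl]
  exact Nat.le_add_left _ _

/-- The invariants of a walk in progress after `L` steps. -/
structure IsReachable (L : ℕ) : Prop where
  deg_le : ∀ x, S.deg x ≤ S.excess + 2
  deg_eq_zero : ∀ x, x ∉ S.visited → S.deg x = 0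
  card_visited_le : #S.visited ≤ L + 1
  card_opened_le : #S.opened ≤ L

theorem IsReachable.start (v : V) : (start v).IsReachable 0 where
  deg_le x := by
    rw [deg_start]
    split_ifs <;> omega
  deg_eq_zero x hx := by
    rw [deg_start, if_neg (by simpa [WalkState.start] using hx)]
  card_visited_le := by simp [WalkState.start]
  card_opened_le := by simp [WalkState.start]

variable {S} {L : ℕ} {w : V}

theorem IsReachable.up (hS : S.IsReachable L) (h : s(S.cur, w) ∉ S.opened) :
    (S.up w).IsReachable (L + 1) where
  deg_le x := by
    rw [S.deg_up h]
    have := hS.deg_le x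
    obtain rfl | hx := eq_or_ne x w
    · by_cases hx : x ∈ S.visited
      · simpa [WalkState.up, hx] using by omega
      · simp [WalkState.up, hx, hS.deg_eq_zero x hx]
    · simpa [WalkState.up, hx] using by omega
  deg_eq_zero x hx := by
    simp only [WalkState.up, Finset.mem_insert, not_or] at hx
    rw [S.deg_up h, hS.deg_eq_zero x hx.2, if_neg hx.1]
  card_visited_le := (Finset.card_insert_le _ _).trans (Nat.succ_le_succ hS.card_visited_le)
  card_opened_le := (Finset.card_insert_le _ _).trans (Nat.succ_le_succ hS.card_opened_le)

theorem IsReachable.down (hS : S.IsReachable L) (h : s(S.cur, w) ∈ S.opened) :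
    (S.down w).IsReachable (L + 1) where
  deg_le x := (Nat.le.intro (S.deg_eq_deg_down_add h x).symm).trans (hS.deg_le x)
  deg_eq_zero x hx := by
    have := S.deg_eq_deg_down_add h x
    have := hS.deg_eq_zero x hx
    omega
  card_visited_le := hS.card_visited_le.trans (Nat.le_succ _)
  card_opened_le := (Finset.card_erase_le.trans hS.card_opened_le).trans (Nat.le_succ _)

theorem IsReachable.transit (hS : S.IsReachable L) (h : s(S.cur, w) ∈ S.opened) :
    (S.transit w).IsReachable (L + 1) where
  deg_le x := by
    change S.openDegree x + (if x = w then 1 else 0) ≤ S.excess + 1 + 2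
    have := hS.deg_le x
    rw [deg] at this
    split_ifs <;> omega
  deg_eq_zero x hx := by
    have deg_x : S.openDegree x + _ = 0 := hS.deg_eq_zero x hx
    have hxw : x ≠ w := by
      rintro rfl
      have := S.one_le_openDegree h
      omega
    change S.openDegree x + (if x = w then 1 else 0) = 0
    rw [if_neg hxw]
    omega
  card_visited_le := hS.card_visited_le.trans (Nat.le_succ _)
  card_opened_le := hS.card_opened_le.trans (Nat.le_succ _)

theorem card_opened_up (h : s(S.cur, w) ∉ S.opened) : #(S.up w).opened = #S.opened + 1 :=
  Finset.card_insert_of_notMem h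

theorem card_opened_down_add_one (h : s(S.cur, w) ∈ S.opened) :
    #(S.down w).opened + 1 = #S.opened :=
  Finset.card_erase_add_one h

variable [Fintype V]

variable (S) in
/-- The vertices that can be reached from the current one through an open edge. -/
def openNeighbors : Finset V := {w | s(S.cur, w) ∈ S.opened}

theorem mem_openNeighbors : w ∈ S.openNeighbors ↔ s(S.cur, w) ∈ S.opened := by
  simp [openNeighbors]

variable (S) in
theorem card_openNeighbors_le : #S.openNeighbors ≤ S.openDegree S.cur := by
  have edge_injective : Function.Injective fun w ↦ s(S.cur, w) := fun a b h ↦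
    Sym2.congr_right.mp h
  rw [← Finset.card_image_of_injective _ edge_injective, Finset.card_eq_sum_ones]
  refine (Finset.sum_le_sum fun e he ↦ ?_).trans (Finset.sum_le_sum_of_subset fun e he ↦ ?_)
  · obtain ⟨w, -, rfl⟩ := Finset.mem_image.mp he
    rw [count_toMultiset_mk, if_pos rfl]
    exact Nat.le_add_right _ _
  · obtain ⟨w, hw, rfl⟩ := Finset.mem_image.mp he
    exact mem_openNeighbors.mp hw

variable (S) in
theorem sum_deg : ∑ x, S.deg x = 2 * #S.opened + 1 := by
  have sum_count (e : Sym2 V) : ∑ x, e.toMultiset.count x = 2 := by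
    rw [Multiset.sum_count_eq_card (by simp), Sym2.card_toMultiset]
  simp only [deg, openDegree, Finset.sum_add_distrib]
  rw [Finset.sum_comm]
  simp [sum_count, mul_comm]

variable (S) in
/-- The potential that pays for the choice among several open edges at the current vertex: the
number of ways to pair off the half-edges at each vertex, as if all degrees were even. -/
def pairings : ℕ := ∏ x, pairingCount (S.deg x)

theorem pairings_start (v : V) : (start v).pairings = 1 := by
  refine Finset.prod_eq_one fun x _ ↦ ?_
  rw [deg_start]
  split_ifs <;> rfl

theorem one_le_pairings : 1 ≤ S.pairings := Finset.one_le_prod' fun _ _ ↦ pairingCount_pos _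

theorem pairings_up (h : s(S.cur, w) ∉ S.opened) :
    (S.up w).pairings = (S.deg w + 1) * S.pairings := by
  simp only [pairings, S.deg_up h, prod_pairingCount_add_two]

theorem pairings_eq_mul_pairings_down (h : s(S.cur, w) ∈ S.opened) :
    S.pairings = S.openDegree S.cur * (S.down w).pairings := by
  have deg_cur_down : (S.down w).deg S.cur + 1 = S.openDegree S.cur := by
    have := S.deg_eq_deg_down_add h S.cur
    rw [S.deg_cur, if_pos rfl] at this
    omega
  rw [pairings, Finset.prod_congr rfl fun x _ ↦ congrArg pairingCount (S.deg_eq_deg_down_add h x),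
    prod_pairingCount_add_two, deg_cur_down, pairings]

theorem sum_pairings_down_le : ∑ w ∈ S.openNeighbors, (S.down w).pairings ≤ S.pairings :=
  sum_le_of_card_mul_le fun w hw ↦ by
    rw [pairings_eq_mul_pairings_down (mem_openNeighbors.mp hw)]
    exact Nat.mul_le_mul_right _ S.card_openNeighbors_le

theorem sum_pairings_transit_le {D : ℕ} (hD : ∀ x, S.deg x ≤ D) :
    ∑ w ∈ S.openNeighbors, (S.transit w).pairings ≤ 2 * D * S.pairings := by
  have openDegree_le (x : V) : S.openDegree x ≤ D := (Nat.le_add_right _ _).trans (hD x)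
  refine sum_le_of_card_mul_le fun w _ ↦ ?_
  exact (Nat.mul_le_mul_right _ S.card_openNeighbors_le).trans
    (mul_prod_pairingCount_add_one_le S.openDegree (openDegree_le S.cur) (openDegree_le w))

end WalkState
end WalkState

/-! ### Upper bound for the weight of the walks in progress -/

theorem sum_fin_succ_pi {α M : Type*} [Fintype α] [AddCommMonoid M] {n : ℕ}
    (f : (Fin (n + 1) → α) → M) : ∑ t, f t = ∑ w, ∑ t : Fin n → α, f (Fin.cons w t) := by
  rw [← Fintype.sum_prod_type']
  exact (Fintype.sum_equiv (Fin.consEquiv fun _ ↦ α) _ _ fun _ ↦ rfl).symm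

namespace WalkState

variable {V : Type*} [DecidableEq V]

/-- The sum of `R ^ excess` over the ways to continue the walk through the vertices `t`, choosing at
each passage through an open edge whether to close it, that leave no edge open. -/
def weight (R : ℝ) : (n : ℕ) → WalkState V → (Fin n → V) → ℝ
  | 0, S, _ => if S.opened = ∅ then R ^ S.excess else 0
  | n + 1, S, t =>
    if s(S.cur, t 0) ∈ S.opened then
      weight R n (S.down (t 0)) (Fin.tail t) + weight R n (S.transit (t 0)) (Fin.tail t)
    else weight R n (S.up (t 0)) (Fin.tail t)

variable [Fintype V] (S : WalkState V)

/-- The sum of `weight` over all continuations with `n` steps. -/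
def totalWeight (R : ℝ) (n : ℕ) : ℝ := ∑ t : Fin n → V, S.weight R n t

theorem totalWeight_succ (R : ℝ) (n : ℕ) :
    S.totalWeight R (n + 1) = ∑ w ∈ S.openNeighborsᶜ, (S.up w).totalWeight R n +
      ∑ w ∈ S.openNeighbors, (S.down w).totalWeight R n +
      ∑ w ∈ S.openNeighbors, (S.transit w).totalWeight R n := by
  have step (w : V) : ∑ t : Fin n → V, S.weight R (n + 1) (Fin.cons w t) =
      if s(S.cur, w) ∈ S.opened then (S.down w).totalWeight R n + (S.transit w).totalWeight R n
      else (S.up w).totalWeight R n := by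
    simp only [weight, Fin.cons_zero, Fin.tail_cons]
    split_ifs
    · exact Finset.sum_add_distrib
    · rfl
  rw [totalWeight, sum_fin_succ_pi, Finset.sum_congr rfl fun w _ ↦ step w, Finset.sum_ite,
    Finset.sum_add_distrib, openNeighbors, Finset.compl_filter]
  ring

/-- The factor of the bound on the total weight of `S` that does not depend on the number of open
edges. The discount `γ` decreases along the induction and absorbs the transits. -/
noncomputable def cost (R γ : ℝ) : ℝ := S.pairings * (R ^ S.excess / γ ^ (S.excess + 2))

variable {S} {R γ : ℝ} {L : ℕ}

theorem cost_nonneg (hR : 0 ≤ R) (hγ : 0 < γ) : 0 ≤ S.cost R γ := by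
  unfold cost
  positivity

theorem sum_cost_down_le (hR : 0 ≤ R) (hγ : 0 < γ) :
    ∑ w ∈ S.openNeighbors, (S.down w).cost R γ ≤ S.cost R γ := by
  simp only [cost, down]
  rw [← Finset.sum_mul]
  gcongr
  exact_mod_cast S.sum_pairings_down_le

theorem IsReachable.sum_cost_transit_le (hS : S.IsReachable L) (hR : 0 ≤ R) (hγ : 0 < γ) :
    ∑ w ∈ S.openNeighbors, (S.transit w).cost R γ ≤
      2 * R * ((S.excess + 2 : ℕ) / γ) * S.cost R γ := by
  have sum_pairings : ∑ w ∈ S.openNeighbors, ((S.transit w).pairings : ℝ) ≤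
      2 * (S.excess + 2 : ℕ) * S.pairings := by
    exact_mod_cast sum_pairings_transit_le hS.deg_le
  calc ∑ w ∈ S.openNeighbors, (S.transit w).cost R γ
      = (∑ w ∈ S.openNeighbors, ((S.transit w).pairings : ℝ)) *
          (R ^ (S.excess + 1) / γ ^ (S.excess + 1 + 2)) := by
        rw [Finset.sum_mul]
        rfl
    _ ≤ 2 * (S.excess + 2 : ℕ) * S.pairings * (R ^ (S.excess + 1) / γ ^ (S.excess + 1 + 2)) := by
        gcongr
    _ = 2 * R * ((S.excess + 2 : ℕ) / γ) * S.cost R γ := by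
        rw [cost]
        field_simp
        ring

theorem cost_up_le (hR : 1 ≤ R) (hγ : 1 / 2 ≤ γ) {w : V} (h : s(S.cur, w) ∉ S.opened) :
    (S.up w).cost R γ ≤
      (if w ∈ S.visited then 4 * R ^ 2 * (S.deg w + 1) else S.deg w + 1 : ℝ) *
        S.cost R γ := by
  have : 0 < γ := by linarith
  rw [cost, pairings_up h]
  split_ifs with hw
  · have discount : R ^ (S.excess + 2) / γ ^ (S.excess + 2 + 2) ≤
        4 * R ^ 2 * (R ^ S.excess / γ ^ (S.excess + 2)) := by
      rw [div_le_iff₀ (by positivity)]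
      have : 1 ≤ 4 * γ ^ 2 := by nlinarith
      calc R ^ (S.excess + 2) ≤ R ^ (S.excess + 2) * (4 * γ ^ 2) :=
            le_mul_of_one_le_right (by positivity) this
        _ = _ := by
          field_simp
          ring
    calc (((S.deg w + 1) * S.pairings : ℕ) : ℝ) *
          (R ^ (S.up w).excess / γ ^ ((S.up w).excess + 2))
        = (S.deg w + 1) * S.pairings * (R ^ (S.excess + 2) / γ ^ (S.excess + 2 + 2)) := by
          simp only [up, if_pos hw]
          push_cast
          rfl
      _ ≤ (S.deg w + 1) * S.pairings * (4 * R ^ 2 * (R ^ S.excess / γ ^ (S.excess + 2))) := by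
          gcongr
      _ = _ := by
          rw [cost]
          ring
  · simp only [up, if_neg hw, add_zero, cost]
    push_cast
    rw [mul_assoc]

theorem IsReachable.sum_cost_up_le (hS : S.IsReachable L) (hR : 1 ≤ R) (hγ : 1 / 2 ≤ γ) :
    ∑ w ∈ S.openNeighborsᶜ, (S.up w).cost R γ ≤
      (Fintype.card V + 4 * R ^ 2 * (3 * L + 2)) * S.cost R γ := by
  let factor (w : V) : ℝ :=
    if w ∈ S.visited then 4 * R ^ 2 * (S.deg w + 1) else S.deg w + 1
  have factor_le (w : V) : factor w ≤
      1 + 4 * R ^ 2 * (S.deg w + if w ∈ S.visited then 1 else 0) := by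
    simp only [factor]
    split_ifs with hw
    · linarith
    · rw [hS.deg_eq_zero w hw]
      simp
  have card_le : (2 * #S.opened + 1 + #S.visited : ℝ) ≤ 3 * L + 2 := by
    have := hS.card_opened_le
    have := hS.card_visited_le
    exact_mod_cast (by omega : 2 * #S.opened + 1 + #S.visited ≤ 3 * L + 2)
  have sum_deg : ∑ w, (S.deg w : ℝ) = 2 * #S.opened + 1 := by exact_mod_cast S.sum_deg
  have hcost : 0 ≤ S.cost R γ := cost_nonneg (by linarith) (by linarith)
  calc ∑ w ∈ S.openNeighborsᶜ, (S.up w).cost R γ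
      ≤ ∑ w ∈ S.openNeighborsᶜ, factor w * S.cost R γ := Finset.sum_le_sum fun w hw ↦
        cost_up_le hR hγ fun h ↦ Finset.mem_compl.mp hw (mem_openNeighbors.mpr h)
    _ ≤ ∑ w, factor w * S.cost R γ :=
        Finset.sum_le_sum_of_subset_of_nonneg (Finset.subset_univ _) fun w _ _ ↦ by positivity
    _ ≤ (∑ w, (1 + 4 * R ^ 2 * (S.deg w + if w ∈ S.visited then 1 else 0))) * S.cost R γ := by
        rw [← Finset.sum_mul]
        gcongr
        exact factor_le _
    _ = (Fintype.card V + 4 * R ^ 2 * (2 * #S.opened + 1 + #S.visited)) * S.cost R γ := by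
        simp [Finset.sum_add_distrib, ← Finset.mul_sum, sum_deg]
    _ ≤ _ := by gcongr

theorem cost_add_le_cost_sub {τ : ℝ} (hR : 0 ≤ R) (hτ : 0 ≤ τ) (hγ : τ < γ) :
    (1 + τ * ((S.excess + 2 : ℕ) / γ)) * S.cost R γ ≤ S.cost R (γ - τ) := by
  have hγ0 : 0 < γ := hτ.trans_lt hγ
  have : 0 < γ - τ := sub_pos.mpr hγ
  set p := S.excess + 2
  have bernoulli : (1 + τ * (p / γ)) * (γ - τ) ^ p ≤ γ ^ p :=
    calc (1 + τ * (p / γ)) * (γ - τ) ^ p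
        = (1 + p * (τ / γ)) * (γ - τ) ^ p := by ring
      _ ≤ (1 + τ / γ) ^ p * (γ - τ) ^ p := by
          gcongr
          exact one_add_mul_le_pow (by linarith [div_nonneg hτ hγ0.le]) p
      _ = (γ - τ * (τ / γ)) ^ p := by
          rw [← mul_pow]
          congr 1
          field_simp
          ring
      _ ≤ γ ^ p := by
          have : τ / γ ≤ 1 := (div_le_one hγ0).mpr hγ.le
          refine pow_le_pow_left₀ ?_ (sub_le_self _ (by positivity)) p
          nlinarith
  calc (1 + τ * (p / γ)) * S.cost R γ
      = S.pairings * R ^ S.excess * ((1 + τ * (p / γ)) / γ ^ p) := by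
        rw [cost]
        ring
    _ ≤ S.pairings * R ^ S.excess * (1 / (γ - τ) ^ p) := by
        gcongr ?_ * ?_
        rw [div_le_div_iff₀ (by positivity) (by positivity), one_mul]
        exact bernoulli
    _ = S.cost R (γ - τ) := by
        rw [cost]
        ring

theorem pow_mul_totalWeight_zero_le {z : ℝ} (hR : 0 ≤ R) :
    z ^ #S.opened * S.totalWeight R 0 ≤ S.cost R 1 * paddedBallot 0 #S.opened := by
  rw [totalWeight, Fintype.sum_unique, weight]
  split_ifs with h
  · have : (1 : ℝ) ≤ S.pairings := by exact_mod_cast S.one_le_pairings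
    simpa [h, cost, paddedBallot, ballot] using le_mul_of_one_le_left (pow_nonneg hR _) this
  · rw [mul_zero]
    exact mul_nonneg (cost_nonneg hR one_pos) (Nat.cast_nonneg _)

theorem sum_le_mul_of_le_mul {ι : Type*} {s : Finset ι} {f c : ι → ℝ} {A b : ℝ} (hb : 0 ≤ b)
    (hc : ∑ i ∈ s, c i ≤ A) (hf : ∀ i ∈ s, f i ≤ c i * b) : ∑ i ∈ s, f i ≤ A * b :=
  calc ∑ i ∈ s, f i ≤ (∑ i ∈ s, c i) * b := by
        rw [Finset.sum_mul]
        exact Finset.sum_le_sum hf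
    _ ≤ A * b := by gcongr

section Step

variable {f : V → ℝ} {z τ b : ℝ}

theorem IsReachable.sum_up_le (hS : S.IsReachable L) (hR : 1 ≤ R) (hγ : 1 / 2 ≤ γ) (hz : 0 < z)
    (hb : 0 ≤ b) (hVz : Fintype.card V + 4 * R ^ 2 * (3 * L + 2) ≤ z ^ 2)
    (hf : ∀ w ∈ S.openNeighborsᶜ, z * f w ≤ (S.up w).cost R γ * b) :
    ∑ w ∈ S.openNeighborsᶜ, f w ≤ S.cost R γ * (z * b) := by
  have hC : 0 ≤ S.cost R γ := cost_nonneg (by linarith) (by linarith)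
  refine le_of_mul_le_mul_left ?_ hz
  calc z * ∑ w ∈ S.openNeighborsᶜ, f w
      = ∑ w ∈ S.openNeighborsᶜ, z * f w := Finset.mul_sum _ _ _
    _ ≤ z ^ 2 * S.cost R γ * b :=
        sum_le_mul_of_le_mul hb ((hS.sum_cost_up_le hR hγ).trans (by gcongr)) hf
    _ = z * (S.cost R γ * (z * b)) := by ring

theorem sum_down_le (hR : 0 ≤ R) (hγ : 0 < γ) (hz : 0 < z) (hb : 0 ≤ b)
    (hf : ∀ w ∈ S.openNeighbors, f w ≤ z * ((S.down w).cost R γ * b)) :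
    ∑ w ∈ S.openNeighbors, f w ≤ S.cost R γ * (z * b) :=
  sum_le_mul_of_le_mul (by positivity) (sum_cost_down_le hR hγ) fun w hw ↦
    (hf w hw).trans_eq (by ring)

theorem IsReachable.sum_transit_le (hS : S.IsReachable L) (hR : 0 ≤ R) (hγ : 0 < γ) (hb : 0 ≤ b)
    (hRz : 2 * R ≤ τ * z) (hf : ∀ w ∈ S.openNeighbors, f w ≤ (S.transit w).cost R γ * b) :
    ∑ w ∈ S.openNeighbors, f w ≤ τ * ((S.excess + 2 : ℕ) / γ) * S.cost R γ * (z * b) := by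
  have hC : 0 ≤ S.cost R γ := cost_nonneg hR hγ
  calc ∑ w ∈ S.openNeighbors, f w
      ≤ 2 * R * ((S.excess + 2 : ℕ) / γ) * S.cost R γ * b :=
        sum_le_mul_of_le_mul hb (hS.sum_cost_transit_le hR hγ) hf
    _ ≤ τ * z * ((S.excess + 2 : ℕ) / γ) * S.cost R γ * b := by gcongr
    _ = τ * ((S.excess + 2 : ℕ) / γ) * S.cost R γ * (z * b) := by ring

theorem IsReachable.pow_mul_totalWeight_succ_le {n : ℕ} (hS : S.IsReachable L)
    (hR : 1 ≤ R) (hz : 0 < z) (hτ : 0 ≤ τ) (hγ : 1 / 2 ≤ γ) (hγτ : τ < γ) (hRz : 2 * R ≤ τ * z)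
    (hVz : Fintype.card V + 4 * R ^ 2 * (3 * L + 2) ≤ z ^ 2)
    (ih : ∀ S' : WalkState V, S'.IsReachable (L + 1) → z ^ #S'.opened * S'.totalWeight R n ≤
      S'.cost R γ * (z ^ n * paddedBallot n #S'.opened)) :
    z ^ #S.opened * S.totalWeight R (n + 1) ≤
      S.cost R (γ - τ) * (z ^ (n + 1) * paddedBallot (n + 1) #S.opened) := by
  have hR0 : 0 ≤ R := by linarith
  have hγ0 : 0 < γ := by linarith
  have hC : 0 ≤ S.cost R γ := cost_nonneg hR0 hγ0
  obtain ⟨k, hk⟩ : ∃ k, k = #S.opened := ⟨_, rfl⟩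
  rw [← hk]
  have hup : ∑ w ∈ S.openNeighborsᶜ, z ^ k * (S.up w).totalWeight R n ≤
      S.cost R γ * (z * (z ^ n * paddedBallot n (k + 1))) := by
    refine hS.sum_up_le hR hγ hz (by positivity) hVz fun w hw ↦ ?_
    have h : s(S.cur, w) ∉ S.opened := by simpa [mem_openNeighbors] using hw
    simpa only [card_opened_up h, ← hk, pow_succ', mul_assoc] using ih _ (hS.up h)
  have hdown : ∑ w ∈ S.openNeighbors, z ^ k * (S.down w).totalWeight R n ≤
      S.cost R γ * (z * (z ^ n * (paddedBallot (n + 1) k - paddedBallot n (k + 1) : ℕ))) := by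
    refine sum_down_le hR0 hγ0 hz (by positivity) fun w hw ↦ ?_
    have h := mem_openNeighbors.mp hw
    rw [hk, ← card_opened_down_add_one h, paddedBallot_succ_succ, Nat.add_sub_cancel_left,
      pow_succ', mul_assoc]
    exact mul_le_mul_of_nonneg_left (ih _ (hS.down h)) hz.le
  have htransit : ∑ w ∈ S.openNeighbors, z ^ k * (S.transit w).totalWeight R n ≤
      τ * ((S.excess + 2 : ℕ) / γ) * S.cost R γ * (z * (z ^ n * paddedBallot n k)) := by
    refine hS.sum_transit_le hR0 hγ0 (by positivity) hRz fun w hw ↦ ?_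
    rw [hk]
    exact ih _ (hS.transit (mem_openNeighbors.mp hw))
  rw [Nat.cast_sub (paddedBallot_succ_le_succ n k)] at hdown
  calc z ^ k * S.totalWeight R (n + 1)
      ≤ S.cost R γ * (z * (z ^ n * paddedBallot (n + 1) k)) +
          τ * ((S.excess + 2 : ℕ) / γ) * S.cost R γ * (z * (z ^ n * paddedBallot n k)) := by
        simp only [totalWeight_succ, mul_add, Finset.mul_sum]
        linarith
    _ ≤ S.cost R γ * (z * (z ^ n * paddedBallot (n + 1) k)) +
          τ * ((S.excess + 2 : ℕ) / γ) * S.cost R γ * (z * (z ^ n * paddedBallot (n + 1) k)) := by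
        gcongr
        exact paddedBallot_le_succ n k
    _ = (1 + τ * ((S.excess + 2 : ℕ) / γ)) * S.cost R γ *
          (z ^ (n + 1) * paddedBallot (n + 1) k) := by ring
    _ ≤ S.cost R (γ - τ) * (z ^ (n + 1) * paddedBallot (n + 1) k) := by
        gcongr
        exact cost_add_le_cost_sub hR0 hτ hγτ

end Step

theorem IsReachable.pow_mul_totalWeight_le {n T : ℕ} {z τ : ℝ} (hS : S.IsReachable L)
    (hLn : L + n ≤ T) (hR : 1 ≤ R) (hz : 0 < z) (hT : T * τ ≤ 1 / 2) (hRz : 2 * R ≤ τ * z)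
    (hVz : Fintype.card V + 4 * R ^ 2 * (3 * T + 2) ≤ z ^ 2) :
    z ^ #S.opened * S.totalWeight R n ≤
      S.cost R (1 - n * τ) * (z ^ n * paddedBallot n #S.opened) := by
  induction n generalizing S L with
  | zero => simpa using pow_mul_totalWeight_zero_le (S := S) (by linarith : 0 ≤ R)
  | succ n ih =>
    have hτ : 0 < τ := pos_of_mul_pos_left (by linarith) hz.le
    have hn : (n + 1) * τ ≤ 1 / 2 := by
      refine le_trans ?_ hT
      gcongr
      exact_mod_cast (by omega : n + 1 ≤ T)
    have hL : (L : ℝ) ≤ T := by exact_mod_cast (by omega : L ≤ T)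
    rw [Nat.cast_succ, add_one_mul, ← sub_sub]
    exact hS.pow_mul_totalWeight_succ_le hR hz hτ.le (by linarith) (by linarith) hRz
      (le_trans (by gcongr) hVz) fun S' hS' ↦ ih hS' (by omega)

theorem totalWeight_start_le (v : V) {m : ℕ} {z τ : ℝ} (hR : 1 ≤ R) (hz : 0 < z)
    (hmτ : (2 * m : ℕ) * τ ≤ 1 / 2) (hRz : 2 * R ≤ τ * z)
    (hVz : Fintype.card V + 4 * R ^ 2 * (3 * (2 * m : ℕ) + 2) ≤ z ^ 2) :
    (start v).totalWeight R (2 * m) ≤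
      z ^ (2 * m) * catalan m / (1 - (2 * m : ℕ) * τ) ^ 2 := by
  have := (IsReachable.start v).pow_mul_totalWeight_le (n := 2 * m) (by simp) hR hz hmτ hRz hVz
  rw [cost, pairings_start] at this
  simpa [start, paddedBallot_two_mul_zero, div_eq_inv_mul] using this

end WalkState

/-! ### From walks to walks in progress -/

section Walk

variable {V : Type*} [DecidableEq V] {n : ℕ}

/-- The number of times the walk `p` passes through the non-oriented edge `e`; for a closed path
this is `ClosedPath.edgeCount`. -/
def passages (p : Fin (n + 1) → V) (e : Sym2 V) : ℕ :=
  #{j : Fin n | s(p j.castSucc, p j.succ) = e}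

theorem passages_cons (v : V) (p : Fin (n + 1) → V) (e : Sym2 V) :
    passages (Fin.cons v p) e = (if s(v, p 0) = e then 1 else 0) + passages p e := by
  rw [passages, passages, Finset.card_filter, Finset.card_filter, Fin.sum_univ_succ]
  rfl

theorem image_cons (v : V) (p : Fin n → V) :
    Finset.univ.image (Fin.cons v p : Fin (n + 1) → V) = insert v (Finset.univ.image p) := by
  ext x
  simp [Fin.exists_fin_succ, eq_comm]

/-- The non-oriented edges through which the walk `p` passes. -/
def walkEdges (p : Fin (n + 1) → V) : Finset (Sym2 V) :=
  Finset.univ.image fun j : Fin n ↦ s(p j.castSucc, p j.succ)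

theorem mem_walkEdges {p : Fin (n + 1) → V} {e : Sym2 V} : e ∈ walkEdges p ↔ passages p e ≠ 0 := by
  simp [walkEdges, passages]

theorem walkEdges_cons (v : V) (p : Fin (n + 1) → V) :
    walkEdges (Fin.cons v p) = insert s(v, p 0) (walkEdges p) := by
  ext e
  rw [Finset.mem_insert, mem_walkEdges, mem_walkEdges, passages_cons]
  split_ifs with h
  · simp [h]
  · rw [zero_add, or_iff_right (Ne.symm h)]

theorem mem_image_of_mem_walkEdges {p : Fin (n + 1) → V} {e : Sym2 V} (he : e ∈ walkEdges p)
    {x : V} (hx : x ∈ e) : x ∈ Finset.univ.image p := by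
  obtain ⟨j, -, rfl⟩ := Finset.mem_image.mp he
  rcases Sym2.mem_iff.mp hx with rfl | rfl <;> exact Finset.mem_image_of_mem _ (Finset.mem_univ _)

theorem card_image_le_card_walkEdges_add_one (p : Fin (n + 1) → V) :
    #(Finset.univ.image p) ≤ #(walkEdges p) + 1 := by
  induction n with
  | zero => exact Finset.card_image_le.trans (by simp)
  | succ n ih =>
    cases p using Fin.consCases with
    | _ v p
    rw [image_cons, walkEdges_cons]
    by_cases hv : v ∈ Finset.univ.image p
    · rw [Finset.insert_eq_of_mem hv]
      exact (ih p).trans (Nat.succ_le_succ (Finset.card_le_card (Finset.subset_insert _ _)))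
    · have new_edge : s(v, p 0) ∉ walkEdges p := fun h ↦
        hv (mem_image_of_mem_walkEdges h (Sym2.mem_mk_left v (p 0)))
      rw [Finset.card_insert_of_notMem hv, Finset.card_insert_of_notMem new_edge]
      exact Nat.succ_le_succ (ih p)

section Excess

variable [Fintype V]

theorem sum_passages (p : Fin (n + 1) → V) : ∑ e, passages p e = n := by
  simpa [passages] using (Finset.card_eq_sum_card_fiberwise (s := Finset.univ)
    (t := Finset.univ) (f := fun j : Fin n ↦ s(p j.castSucc, p j.succ)) (by simp)).symm

/-- The number of passages of the walk `p` beyond the second one through each edge; edges that are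
not passed contribute `0` by truncated subtraction. -/
def walkExcess (p : Fin (n + 1) → V) : ℕ := ∑ e, (passages p e - 2)

theorem walkExcess_add_two_mul_card_walkEdges {p : Fin (n + 1) → V} (h : ∀ e, passages p e ≠ 1) :
    walkExcess p + 2 * #(walkEdges p) = n := by
  have card_eq : #(walkEdges p) = ∑ e, if passages p e ≠ 0 then 1 else 0 := by
    rw [← Finset.card_filter]
    congr 1
    ext e
    simp [mem_walkEdges]
  conv_rhs => rw [← sum_passages p]
  rw [walkExcess, card_eq, Finset.mul_sum, ← Finset.sum_add_distrib]
  refine Finset.sum_congr rfl fun e _ ↦ ?_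
  have := h e
  split_ifs <;> omega

/-- A bound, up to a power of the standard deviation, for the expectation of the product of matrix
entries along `p`: it vanishes when an edge is passed exactly once. -/
noncomputable def walkWeight (R : ℝ) (p : Fin (n + 1) → V) : ℝ :=
  if ∀ e, passages p e ≠ 1 then R ^ walkExcess p else 0

theorem walkWeight_nonneg {R : ℝ} (hR : 0 ≤ R) (p : Fin (n + 1) → V) : 0 ≤ walkWeight R p := by
  rw [walkWeight]
  positivity

end Excess

namespace WalkState

variable {S : WalkState V}

/-- Following the vertices `t` from the state `S`, each open edge is passed again and no other edge
is passed exactly once. -/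
def IsCompletedBy (S : WalkState V) (t : Fin n → V) : Prop :=
  (∀ e ∈ S.opened, passages (Fin.cons S.cur t) e ≠ 0) ∧
    ∀ e ∉ S.opened, passages (Fin.cons S.cur t) e ≠ 1

theorem isCompletedBy_start {v : V} {t : Fin n → V}
    (h : ∀ e, passages (Fin.cons v t) e ≠ 1) : (start v).IsCompletedBy t :=
  ⟨fun e he ↦ absurd he (Finset.notMem_empty e), fun e _ ↦ h e⟩

theorem IsCompletedBy.opened_eq_empty {t : Fin 0 → V} (h : S.IsCompletedBy t) : S.opened = ∅ :=
  Finset.eq_empty_of_forall_notMem fun e he ↦ h.1 e he rfl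

theorem passages_cons_cur {v : V} (t : Fin (n + 1) → V) (e : Sym2 V) :
    passages (Fin.cons v t) e =
      (if s(v, t 0) = e then 1 else 0) + passages (Fin.cons (t 0) (Fin.tail t)) e := by
  rw [Fin.cons_self_tail, passages_cons]

variable {t : Fin (n + 1) → V}

theorem IsCompletedBy.up (h : S.IsCompletedBy t) (ht : s(S.cur, t 0) ∉ S.opened) :
    (S.up (t 0)).IsCompletedBy (Fin.tail t) := by
  obtain ⟨h_open, h_other⟩ := h
  simp only [passages_cons_cur t] at h_open h_other
  refine ⟨fun e he ↦ ?_, fun e he ↦ ?_⟩ <;> simp only [WalkState.up, Finset.mem_insert] at he ⊢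
  · obtain rfl | he := he
    · simpa using h_other _ ht
    · simpa [show s(S.cur, t 0) ≠ e from fun h ↦ ht (h ▸ he)] using h_open e he
  · rw [not_or] at he
    simpa [Ne.symm he.1] using h_other e he.2

theorem IsCompletedBy.down (h : S.IsCompletedBy t)
    (ht : passages (Fin.cons (t 0) (Fin.tail t)) s(S.cur, t 0) ≠ 1) :
    (S.down (t 0)).IsCompletedBy (Fin.tail t) := by
  obtain ⟨h_open, h_other⟩ := h
  simp only [passages_cons_cur t] at h_open h_other
  refine ⟨fun e he ↦ ?_, fun e he ↦ ?_⟩ <;> simp only [WalkState.down, Finset.mem_erase] at he ⊢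
  · simpa [Ne.symm he.1] using h_open e he.2
  · obtain rfl | hne := eq_or_ne e s(S.cur, t 0)
    · exact ht
    · simpa [hne.symm] using h_other e fun h ↦ he ⟨hne, h⟩

theorem IsCompletedBy.transit (h : S.IsCompletedBy t)
    (ht : passages (Fin.cons (t 0) (Fin.tail t)) s(S.cur, t 0) = 1)
    (hmem : s(S.cur, t 0) ∈ S.opened) :
    (S.transit (t 0)).IsCompletedBy (Fin.tail t) := by
  obtain ⟨h_open, h_other⟩ := h
  simp only [passages_cons_cur t] at h_open h_other
  refine ⟨fun e he ↦ ?_, fun e he ↦ ?_⟩ <;> simp only [WalkState.transit] at he ⊢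
  · obtain rfl | hne := eq_or_ne e s(S.cur, t 0)
    · exact ne_of_eq_of_ne ht one_ne_zero
    · simpa [hne.symm] using h_open e he
  · simpa [show s(S.cur, t 0) ≠ e from fun h ↦ he (h ▸ hmem)] using h_other e he

theorem weight_nonneg {R : ℝ} (hR : 0 ≤ R) (S : WalkState V) (t : Fin n → V) :
    0 ≤ S.weight R n t := by
  induction n generalizing S with
  | zero =>
    rw [weight]
    positivity
  | succ n ih =>
    rw [weight]
    split_ifs
    · exact add_nonneg (ih _ _) (ih _ _)
    · exact ih _ _

/-- `hm` bounds `m` by the final excess: every open edge costs one more step to close, and every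
vertex still to be discovered two steps, one to open an edge and one to close it. -/
theorem IsCompletedBy.pow_le_weight {R : ℝ} (hR : 1 ≤ R) {m : ℕ} {t : Fin n → V}
    (h : S.IsCompletedBy t)
    (hm : m + #S.opened + 2 * #(S.visited ∪ Finset.univ.image t) ≤
      S.excess + n + 2 * #S.visited) :
    R ^ m ≤ S.weight R n t := by
  induction n generalizing S with
  | zero =>
    rw [weight, if_pos h.opened_eq_empty]
    refine pow_le_pow_right₀ hR ?_
    simp only [Finset.univ_eq_empty, Finset.image_empty, Finset.union_empty] at hm
    omega
  | succ n ih =>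
    have image_eq : Finset.univ.image t = insert (t 0) (Finset.univ.image (Fin.tail t)) := by
      rw [← image_cons, Fin.cons_self_tail]
    have card_union_le : #(S.visited ∪ Finset.univ.image (Fin.tail t)) ≤
        #(S.visited ∪ Finset.univ.image t) := by
      rw [image_eq]
      exact Finset.card_le_card (Finset.union_subset_union_right (Finset.subset_insert _ _))
    have nonneg (S' : WalkState V) : 0 ≤ S'.weight R n (Fin.tail t) :=
      weight_nonneg (by linarith) _ _
    rw [weight]
    split_ifs with hmem
    · by_cases hone : passages (Fin.cons (t 0) (Fin.tail t)) s(S.cur, t 0) = 1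
      · refine le_add_of_nonneg_of_le (nonneg _) (ih (h.transit hone hmem) ?_)
        simp only [WalkState.transit]
        omega
      · refine le_add_of_le_of_nonneg (ih (h.down hone) ?_) (nonneg _)
        have := card_opened_down_add_one hmem
        simp only [WalkState.down] at this ⊢
        omega
    · refine ih (h.up hmem) ?_
      have card_visited : (S.up (t 0)).excess + 2 * #(S.up (t 0)).visited =
          S.excess + 2 * #S.visited + 2 := by
        by_cases hv : t 0 ∈ S.visited
        · simp [WalkState.up, hv]
          omega
        · simp [WalkState.up, hv]
          omega
      have union_eq : (S.up (t 0)).visited ∪ Finset.univ.image (Fin.tail t) =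
          S.visited ∪ Finset.univ.image t := by
        rw [image_eq, Finset.union_insert]
        exact Finset.insert_union _ _ _
      rw [union_eq, card_opened_up hmem]
      omega

variable [Fintype V]

theorem walkWeight_cons_le_weight_start {R : ℝ} (hR : 1 ≤ R) (v : V) (t : Fin n → V) :
    walkWeight R (Fin.cons v t) ≤ (start v).weight R n t := by
  rw [walkWeight]
  split_ifs with h
  · refine (isCompletedBy_start h).pow_le_weight hR ?_
    have := walkExcess_add_two_mul_card_walkEdges h
    have := card_image_le_card_walkEdges_add_one (Fin.cons v t)
    rw [image_cons] at this
    simp only [start, Finset.card_empty, Finset.card_singleton, Finset.singleton_union]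
    omega
  · exact weight_nonneg (by linarith) _ _

end WalkState

theorem sum_walkWeight_le [Fintype V] {m : ℕ} {R z τ : ℝ} (hR : 1 ≤ R) (hz : 0 < z)
    (hmτ : (2 * m : ℕ) * τ ≤ 1 / 2) (hRz : 2 * R ≤ τ * z)
    (hVz : Fintype.card V + 4 * R ^ 2 * (3 * (2 * m : ℕ) + 2) ≤ z ^ 2) :
    ∑ p : Fin (2 * m + 1) → V, walkWeight R p ≤
      Fintype.card V * (z ^ (2 * m) * catalan m / (1 - (2 * m : ℕ) * τ) ^ 2) :=
  calc ∑ p : Fin (2 * m + 1) → V, walkWeight R p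
      ≤ ∑ v, (WalkState.start v).totalWeight R (2 * m) := by
        rw [sum_fin_succ_pi]
        exact Finset.sum_le_sum fun v _ ↦ Finset.sum_le_sum fun t _ ↦
          WalkState.walkWeight_cons_le_weight_start hR v t
    _ ≤ ∑ _v : V, z ^ (2 * m) * catalan m / (1 - (2 * m : ℕ) * τ) ^ 2 :=
        Finset.sum_le_sum fun v _ ↦ WalkState.totalWeight_start_le v hR hz hmτ hRz hVz
    _ = _ := by rw [Finset.sum_const, Finset.card_univ, nsmul_eq_mul]

end Walk

/-! ### Walks that backtrack along a path -/

section LowerBound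

variable {V : Type*} [DecidableEq V] {n : ℕ}

/-- The edges of the path that visits the vertices of the list in order. -/
def pathEdges : List V → Finset (Sym2 V)
  | v :: w :: l => insert s(v, w) (pathEdges (w :: l))
  | _ => ∅

theorem notMem_pathEdges {l : List V} {v : V} (hv : v ∉ l) (w : V) : s(v, w) ∉ pathEdges l := by
  induction l with
  | nil => simp [pathEdges]
  | cons a l ih =>
    rcases l with _ | ⟨b, l⟩
    · simp [pathEdges]
    · simp only [List.mem_cons, not_or] at hv ih
      simp [pathEdges, ih hv.2, hv.1, hv.2.1]

theorem symmDiff_pathEdges_push {v w : V} {l : List V} (hw : w ∉ v :: l) :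
    symmDiff (pathEdges (v :: l)) {s(v, w)} = pathEdges (w :: v :: l) := by
  rw [Sym2.eq_swap, (Finset.disjoint_singleton_right.mpr (notMem_pathEdges hw v)).symmDiff_eq_sup,
    pathEdges, Finset.sup_eq_union, Finset.union_comm, Finset.insert_eq]

theorem symmDiff_pathEdges_pop {v b : V} {l : List V} (hv : v ∉ b :: l) :
    symmDiff (pathEdges (v :: b :: l)) {s(v, b)} = pathEdges (b :: l) := by
  rw [← symmDiff_pathEdges_push hv, Sym2.eq_swap, symmDiff_symmDiff_cancel_right]

variable [Fintype V]

/-- The non-oriented edges through which the walk `p` passes an odd number of times. -/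
def oddEdges (p : Fin (n + 1) → V) : Finset (Sym2 V) := {e | Odd (passages p e)}

theorem oddEdges_cons (v : V) (p : Fin (n + 1) → V) :
    oddEdges (Fin.cons v p) = symmDiff (oddEdges p) {s(v, p 0)} := by
  ext e
  by_cases h : s(v, p 0) = e
  · simp [oddEdges, passages_cons, Finset.mem_symmDiff, h, Nat.odd_add, parity_simps]
  · simp [oddEdges, passages_cons, Finset.mem_symmDiff, h, Ne.symm h]

/-- The number of walks of `n` steps from `v` to `r` whose set of odd edges is `O`. -/
def oddWalkCount (n : ℕ) (v r : V) (O : Finset (Sym2 V)) : ℕ :=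
  #{t : Fin n → V | (Fin.cons v t : Fin (n + 1) → V) (Fin.last n) = r ∧
    oddEdges (Fin.cons v t) = O}

theorem oddWalkCount_zero (v : V) : oddWalkCount 0 v v ∅ = 1 := by
  simp [oddWalkCount, oddEdges, passages]

theorem oddWalkCount_succ (n : ℕ) (v r : V) (O : Finset (Sym2 V)) :
    oddWalkCount (n + 1) v r O = ∑ w, oddWalkCount n w r (symmDiff O {s(v, w)}) := by
  simp only [oddWalkCount, Finset.card_filter]
  rw [sum_fin_succ_pi]
  refine Finset.sum_congr rfl fun w _ ↦ Finset.sum_congr rfl fun t _ ↦ ?_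
  rw [oddEdges_cons, ← Fin.succ_last, Fin.cons_succ, Fin.cons_zero]
  congr 1
  rw [eq_iff_iff, and_congr_right_iff]
  exact fun _ ↦ ⟨fun h ↦ by rw [← h, symmDiff_symmDiff_cancel_right],
    fun h ↦ by rw [h, symmDiff_symmDiff_cancel_right]⟩

theorem sum_oddWalkCount_push_le (v r : V) (l : List V) :
    ∑ w ∈ (v :: l).toFinsetᶜ, oddWalkCount n w r (pathEdges (w :: v :: l)) ≤
      oddWalkCount (n + 1) v r (pathEdges (v :: l)) := by
  rw [oddWalkCount_succ]
  calc ∑ w ∈ (v :: l).toFinsetᶜ, oddWalkCount n w r (pathEdges (w :: v :: l))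
      = ∑ w ∈ (v :: l).toFinsetᶜ, oddWalkCount n w r (symmDiff (pathEdges (v :: l)) {s(v, w)}) :=
        Finset.sum_congr rfl fun w hw ↦ by rw [symmDiff_pathEdges_push (by simpa using hw)]
    _ ≤ _ := Finset.sum_le_sum_of_subset (Finset.subset_univ _)

theorem oddWalkCount_pop_add_sum_push_le {v b : V} {l : List V} (hv : v ∉ b :: l) (r : V) :
    oddWalkCount n b r (pathEdges (b :: l)) +
        ∑ w ∈ (v :: b :: l).toFinsetᶜ, oddWalkCount n w r (pathEdges (w :: v :: b :: l)) ≤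
      oddWalkCount (n + 1) v r (pathEdges (v :: b :: l)) := by
  rw [oddWalkCount_succ]
  calc oddWalkCount n b r (pathEdges (b :: l)) +
        ∑ w ∈ (v :: b :: l).toFinsetᶜ, oddWalkCount n w r (pathEdges (w :: v :: b :: l))
      = ∑ w ∈ insert b (v :: b :: l).toFinsetᶜ,
          oddWalkCount n w r (symmDiff (pathEdges (v :: b :: l)) {s(v, w)}) := by
        rw [Finset.sum_insert (by simp), symmDiff_pathEdges_pop hv]
        exact congrArg _ (Finset.sum_congr rfl fun w hw ↦ by
          rw [symmDiff_pathEdges_push (by simpa using hw)])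
    _ ≤ _ := Finset.sum_le_sum_of_subset (Finset.subset_univ _)

theorem mul_le_sum_compl {s : Finset V} {y B : ℝ} {f : V → ℕ} (hy : 0 < y) (hB : 0 ≤ B)
    (hs : y ^ 2 + #s ≤ Fintype.card V) (hf : ∀ w ∉ s, B ≤ y * f w) :
    y * B ≤ (∑ w ∈ sᶜ, f w : ℕ) := by
  have sq_le_card : y ^ 2 ≤ #sᶜ := by
    rw [Finset.card_compl, Nat.cast_sub (Finset.card_le_univ s)]
    linarith
  refine le_of_mul_le_mul_left ?_ hy
  calc y * (y * B) = y ^ 2 * B := by ring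
    _ ≤ #sᶜ • B := by
      rw [nsmul_eq_mul]
      gcongr
    _ ≤ ∑ w ∈ sᶜ, y * f w :=
      Finset.card_nsmul_le_sum _ _ _ fun w hw ↦ hf w (Finset.mem_compl.mp hw)
    _ = y * (∑ w ∈ sᶜ, f w : ℕ) := by rw [Nat.cast_sum, Finset.mul_sum]

theorem ballot_mul_pow_le_oddWalkCount {y : ℝ} (hy : 0 < y) {v r : V} {l : List V}
    (hl : (v :: l).Nodup) (hr : (v :: l).getLast (List.cons_ne_nil v l) = r)
    (hV : y ^ 2 + (l.length + n + 1 : ℕ) ≤ Fintype.card V) :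
    ballot n l.length * y ^ n ≤ y ^ l.length * oddWalkCount n v r (pathEdges (v :: l)) := by
  induction n generalizing v l with
  | zero =>
    rcases l with _ | ⟨b, l⟩
    · obtain rfl : v = r := hr
      simp [pathEdges, oddWalkCount_zero, ballot]
    · simp only [List.length_cons, ballot, Nat.cast_zero, zero_mul]
      positivity
  | succ n ih =>
    have sum_push_ge : y * (ballot n (l.length + 1) * y ^ n) ≤ y ^ l.length *
        (∑ w ∈ (v :: l).toFinsetᶜ, oddWalkCount n w r (pathEdges (w :: v :: l)) : ℕ) := by
      rw [← div_le_iff₀' (by positivity), mul_div_assoc]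
      refine mul_le_sum_compl hy (by positivity) ?_ fun w hw ↦ ?_
      · rw [List.toFinset_card_of_nodup hl, List.length_cons]
        exact hV.trans' (by gcongr; omega)
      · rw [List.mem_toFinset] at hw
        rw [div_le_iff₀' (by positivity), ← mul_assoc, ← pow_succ]
        exact ih (l := v :: l) (List.nodup_cons.mpr ⟨hw, hl⟩) (by rwa [List.getLast_cons])
          (hV.trans' (by rw [List.length_cons]; gcongr 2; omega))
    rcases l with _ | ⟨b, l⟩
    · calc ballot (n + 1) 0 * y ^ (n + 1) = y * (ballot n 1 * y ^ n) := by rw [ballot]; ring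
        _ ≤ _ := sum_push_ge
        _ ≤ _ := by gcongr; exact sum_oddWalkCount_push_le v r []
    · obtain ⟨hv, hbl⟩ := List.nodup_cons.mp hl
      have pop_ge : ballot n l.length * y ^ n ≤
          y ^ l.length * oddWalkCount n b r (pathEdges (b :: l)) :=
        ih hbl (by rwa [List.getLast_cons] at hr) (hV.trans' (by gcongr <;> simp))
      calc (ballot (n + 1) (l.length + 1) : ℝ) * y ^ (n + 1)
          = y * (ballot n l.length * y ^ n) + y * (ballot n (l.length + 2) * y ^ n) := by
            rw [ballot]; push_cast; ring
        _ ≤ y * (y ^ l.length * oddWalkCount n b r (pathEdges (b :: l))) + _ :=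
            add_le_add (mul_le_mul_of_nonneg_left pop_ge hy.le) sum_push_ge
        _ = y ^ (l.length + 1) * (oddWalkCount n b r (pathEdges (b :: l)) + _ : ℕ) := by
            rw [List.length_cons, Nat.cast_add]; ring
        _ ≤ _ := mul_le_mul_of_nonneg_left
            (Nat.cast_le.mpr (oddWalkCount_pop_add_sum_push_le hv r)) (by positivity)

theorem catalan_mul_pow_le_oddWalkCount {y : ℝ} (hy : 0 < y) {m : ℕ}
    (hV : y ^ 2 + (2 * m + 1 : ℕ) ≤ Fintype.card V) (v : V) :
    catalan m * (y ^ 2) ^ m ≤ oddWalkCount (2 * m) v v ∅ := by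
  have := ballot_mul_pow_le_oddWalkCount hy (List.nodup_singleton v) rfl (n := 2 * m)
    (hV.trans' (by gcongr; simp))
  simpa [ballot_two_mul_zero, pathEdges, pow_mul] using this

end LowerBound

/-! ### Moments and expectations -/

section Moments

variable {μ : Measure ℝ} {σ M B : ℝ}

theorem integrable_pow_of_ae_abs_le [IsFiniteMeasure μ] (hM : ∀ᵐ x ∂μ, |x| ≤ M) (c : ℕ) :
    Integrable (fun x : ℝ ↦ x ^ c) μ := by
  refine Integrable.of_bound (by fun_prop) (M ^ c) (hM.mono fun x hx ↦ ?_)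
  rw [norm_pow, Real.norm_eq_abs]
  gcongr

theorem exists_ae_abs_le_mul_abs [IsFiniteMeasure μ] (hM : ∀ᵐ x ∂μ, |x| ≤ M)
    (hσ : ∫ x, x ^ 2 ∂μ = σ ^ 2) : ∃ R : ℝ, 1 ≤ R ∧ ∀ᵐ x ∂μ, |x| ≤ R * |σ| := by
  obtain rfl | h := eq_or_ne σ 0
  · rw [zero_pow two_ne_zero, integral_eq_zero_iff_of_nonneg (fun x ↦ sq_nonneg x)
      (integrable_pow_of_ae_abs_le hM 2)] at hσ
    refine ⟨1, le_rfl, hσ.mono fun x hx ↦ ?_⟩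
    simp [pow_eq_zero_iff two_ne_zero |>.mp hx]
  · refine ⟨max 1 (M / |σ|), le_max_left _ _, hM.mono fun x hx ↦ ?_⟩
    rw [← div_le_iff₀ (abs_pos.mpr h)]
    exact le_max_of_le_right (by gcongr)

theorem abs_integral_pow_add_two_le [IsFiniteMeasure μ] (hB : ∀ᵐ x ∂μ, |x| ≤ B) (c : ℕ) :
    |∫ x, x ^ (c + 2) ∂μ| ≤ B ^ c * ∫ x, x ^ 2 ∂μ :=
  calc |∫ x, x ^ (c + 2) ∂μ| ≤ ∫ x, |x ^ (c + 2)| ∂μ := abs_integral_le_integral_abs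
    _ ≤ ∫ x, B ^ c * x ^ 2 ∂μ := by
      refine integral_mono_ae (integrable_pow_of_ae_abs_le hB _).abs
        ((integrable_pow_of_ae_abs_le hB 2).const_mul _) (hB.mono fun x hx ↦ ?_)
      dsimp only
      rw [abs_pow, pow_add, sq_abs]
      gcongr
    _ = B ^ c * ∫ x, x ^ 2 ∂μ := integral_const_mul _ _

theorem pow_integral_sq_le [IsProbabilityMeasure μ] (hM : ∀ᵐ x ∂μ, |x| ≤ M) (k : ℕ) :
    (∫ x, x ^ 2 ∂μ) ^ k ≤ ∫ x, x ^ (2 * k) ∂μ := by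
  simp only [pow_mul]
  refine (convexOn_pow k).map_integral_le (continuousOn_pow k) isClosed_Ici
    (.of_forall fun x ↦ sq_nonneg x) (integrable_pow_of_ae_abs_le hM 2) ?_
  simpa only [Function.comp_def, ← pow_mul] using integrable_pow_of_ae_abs_le hM (2 * k)

theorem IsEntryLaw.exists_ae_abs_le (hμ : IsEntryLaw μ σ) : ∃ M : ℝ, ∀ᵐ x ∂μ, |x| ≤ M := by
  obtain ⟨M, hM⟩ := hμ.compact_support.isBounded.exists_norm_le
  exact ⟨M, Filter.mem_of_superset Measure.support_mem_ae hM⟩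

variable [IsProbabilityMeasure μ]

theorem abs_moment_le {R : ℝ} (hσ : ∫ x, x ^ 2 ∂μ = σ ^ 2) (hR : ∀ᵐ x ∂μ, |x| ≤ R * |σ|) {c : ℕ}
    (hc : c ≠ 1) : |∫ x, x ^ c ∂μ| ≤ |σ| ^ c * R ^ (c - 2) := by
  rcases c with _ | _ | c
  · simp
  · contradiction
  · calc |∫ x, x ^ (c + 2) ∂μ| ≤ (R * |σ|) ^ c * σ ^ 2 :=
          hσ ▸ abs_integral_pow_add_two_le hR c
      _ = |σ| ^ (c + 2) * R ^ c := by rw [← sq_abs σ]; ring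

theorem pow_le_moment (hσ : ∫ x, x ^ 2 ∂μ = σ ^ 2) (hM : ∀ᵐ x ∂μ, |x| ≤ M) {c : ℕ}
    (hc : Even c) : |σ| ^ c ≤ ∫ x, x ^ c ∂μ := by
  obtain ⟨k, rfl⟩ := hc.two_dvd
  rw [pow_mul, sq_abs, ← hσ]
  exact pow_integral_sq_le hM k

end Moments

section Expectation

variable {N n : ℕ} {Ω : Type*} {a : Fin N → Fin N → Ω → ℝ}

theorem entryProd_randomMatrix (p : ClosedPath N n) (ω : Ω) :
    p.entryProd (randomMatrix a ω) =
      (1 / √N) ^ n * ∏ j : Fin n, a (p.1 j.castSucc) (p.1 j.succ) ω := by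
  simp [ClosedPath.entryProd, randomMatrix, Finset.prod_mul_distrib]

variable [MeasurableSpace Ω] {P : Measure Ω} {μ : Measure ℝ}

namespace IsSymmetricIID

theorem hasLaw (ha : IsSymmetricIID P μ a) (i j : Fin N) : HasLaw (a i j) μ P := by
  rcases le_total i j with h | h
  · exact ha.law i j h
  · rw [show a i j = a j i from funext fun ω ↦ ha.symm i j ω]
    exact ha.law j i h

theorem eq_inf_sup (ha : IsSymmetricIID P μ a) (i j : Fin N) (ω : Ω) :
    a i j ω = a s(i, j).inf s(i, j).sup ω := by
  rcases le_total i j with h | h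
  · simp [h]
  · simp [h, ha.symm i j]

theorem prod_eq_prod_pow (ha : IsSymmetricIID P μ a) (p : Fin (n + 1) → Fin N) (ω : Ω) :
    ∏ j : Fin n, a (p j.castSucc) (p j.succ) ω = ∏ e, a e.inf e.sup ω ^ passages p e := by
  simp only [ha.eq_inf_sup (p _), passages, ← Finset.prod_const]
  exact (Finset.prod_fiberwise' _ _ fun e : Sym2 (Fin N) ↦ a e.inf e.sup ω).symm

theorem integral_entryProd (ha : IsSymmetricIID P μ a) (p : ClosedPath N n) :
    ∫ ω, p.entryProd (randomMatrix a ω) ∂P =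
      (1 / √N) ^ n * ∏ e, ∫ x, x ^ passages p.1 e ∂μ := by
  simp_rw [entryProd_randomMatrix, ha.prod_eq_prod_pow]
  rw [integral_const_mul]
  congr 1
  have indep_pow : iIndepFun (fun e : Sym2 (Fin N) ↦ fun ω ↦ a e.inf e.sup ω ^ passages p.1 e) P :=
    (ha.indep.precomp (Sym2.sortEquiv (α := Fin N)).injective).comp
      (fun e x ↦ x ^ passages p.1 e) fun e ↦ by fun_prop
  rw [indep_pow.integral_fun_prod_eq_prod_integral fun e ↦
    ((ha.hasLaw e.inf e.sup).aemeasurable.pow_const _).aestronglyMeasurable]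
  exact Finset.prod_congr rfl fun e _ ↦
    (ha.hasLaw e.inf e.sup).integral_comp (f := fun x ↦ x ^ passages p.1 e) (by fun_prop)

theorem integrable_entryProd (ha : IsSymmetricIID P μ a) {M : ℝ} (hM : ∀ᵐ x ∂μ, |x| ≤ M)
    (p : ClosedPath N n) : Integrable (fun ω ↦ p.entryProd (randomMatrix a ω)) P := by
  have := ha.indep.isProbabilityMeasure
  have entries_bounded : ∀ᵐ ω ∂P, ∀ i j, |a i j ω| ≤ M :=
    ae_all_iff.mpr fun i ↦ ae_all_iff.mpr fun j ↦
      ((ha.hasLaw i j).ae_iff (p := fun x ↦ |x| ≤ M) (by fun_prop)).mpr hM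
  simp_rw [entryProd_randomMatrix]
  refine Integrable.const_mul (Integrable.of_bound ?_ (M ^ n) ?_) _
  · exact (Finset.aemeasurable_fun_prod _ fun j _ ↦
      (ha.hasLaw _ _).aemeasurable).aestronglyMeasurable
  · filter_upwards [entries_bounded] with ω hω
    rw [Real.norm_eq_abs, Finset.abs_prod]
    exact (Finset.prod_le_prod (fun _ _ ↦ abs_nonneg _) fun j _ ↦ hω _ _).trans (by simp)

end IsSymmetricIID

theorem pow_apply_eq_sum_walk {V K : Type*} [Fintype V] [DecidableEq V] [CommSemiring K]
    (A : Matrix V V K) (n : ℕ) (v u : V) :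
    (A ^ n) v u = ∑ t : Fin n → V, if (Fin.cons v t : Fin (n + 1) → V) (Fin.last n) = u then
      ∏ j : Fin n, A ((Fin.cons v t : Fin (n + 1) → V) j.castSucc) (t j) else 0 := by
  induction n generalizing v with
  | zero => simp [Matrix.one_apply]
  | succ n ih =>
    rw [pow_succ', Matrix.mul_apply, sum_fin_succ_pi]
    refine Finset.sum_congr rfl fun w _ ↦ ?_
    rw [ih, Finset.mul_sum]
    refine Finset.sum_congr rfl fun t _ ↦ ?_
    rw [Fin.prod_univ_succ, mul_ite, mul_zero]
    rfl

theorem sum_closedPath {M : Type*} [AddCommMonoid M] (f : (Fin (n + 1) → Fin N) → M) :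
    ∑ p : ClosedPath N n, f p.1 = ∑ v, ∑ t : Fin n → Fin N,
      if (Fin.cons v t : Fin (n + 1) → Fin N) (Fin.last n) = v then f (Fin.cons v t) else 0 := by
  rw [← Finset.sum_subtype {p : Fin (n + 1) → Fin N | p (Fin.last n) = p 0} (by simp) f,
    Finset.sum_filter, sum_fin_succ_pi]
  rfl

theorem trace_pow_eq_sum_entryProd (A : Matrix (Fin N) (Fin N) ℝ) (n : ℕ) :
    (A ^ n).trace = ∑ p : ClosedPath N n, p.entryProd A := by
  simp only [ClosedPath.entryProd, Matrix.trace, Matrix.diag, pow_apply_eq_sum_walk]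
  exact (sum_closedPath fun p ↦ ∏ j : Fin n, A (p j.castSucc) (p j.succ)).symm

open Classical in
theorem sum_even_add_sum_odd (f : ClosedPath N n → ℝ) :
    (∑ p with p.IsEven, f p) + ∑ p with p.IsOdd, f p = ∑ p, f p := by
  have isOdd_iff (p : ClosedPath N n) : p.IsOdd ↔ ¬p.IsEven := by
    simp [ClosedPath.IsOdd, ClosedPath.IsEven]
  simp only [isOdd_iff, Finset.sum_filter_add_sum_filter_not]

theorem evenContribution_add_oddContribution
    (h : ∀ p : ClosedPath N n, Integrable (fun ω ↦ p.entryProd (randomMatrix a ω)) P) :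
    evenContribution P a n + oddContribution P a n = expectedTrace P a n := by
  simp_rw [expectedTrace, trace_pow_eq_sum_entryProd]
  rw [integral_finsetSum _ fun p _ ↦ h p, evenContribution, oddContribution, sum_even_add_sum_odd]

end Expectation

/-! ### Bounds for the even and odd contributions -/

section Bounds

variable {N n m : ℕ} {Ω : Type*} [MeasurableSpace Ω] {P : Measure Ω} {μ : Measure ℝ} {σ M R : ℝ}
  {a : Fin N → Fin N → Ω → ℝ}

open Classical in
theorem card_even_closedPath :
    #{p : ClosedPath N n | p.IsEven} = ∑ v : Fin N, oddWalkCount n v v ∅ := by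
  have isEven_iff (p : ClosedPath N n) : p.IsEven ↔ oddEdges p.1 = ∅ := by
    simp only [oddEdges, Finset.filter_eq_empty_iff, Finset.mem_univ, true_implies,
      Nat.not_odd_iff_even]
    rfl
  simp only [isEven_iff, Finset.card_filter, oddWalkCount, ite_and]
  exact sum_closedPath fun p ↦ if oddEdges p = ∅ then 1 else 0

open Classical in
theorem catalan_mul_pow_le_card_even_closedPath (h : 2 * m + 1 < N) :
    N * (catalan m * (N - (2 * m + 1 : ℕ) : ℝ) ^ m) ≤ #{p : ClosedPath N (2 * m) | p.IsEven} := by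
  have room_pos : 0 < (N - (2 * m + 1 : ℕ) : ℝ) := sub_pos.mpr (Nat.cast_lt.mpr h)
  have sq_sqrt := Real.sq_sqrt room_pos.le
  have count_ge (v : Fin N) :
      catalan m * (N - (2 * m + 1 : ℕ) : ℝ) ^ m ≤ oddWalkCount (2 * m) v v ∅ := by
    have := catalan_mul_pow_le_oddWalkCount (Real.sqrt_pos.mpr room_pos) (m := m) (v := v)
      (by rw [sq_sqrt, sub_add_cancel, Fintype.card_fin])
    rwa [sq_sqrt] at this
  rw [card_even_closedPath, Nat.cast_sum]
  simpa using Finset.sum_le_sum fun v (_ : v ∈ Finset.univ) ↦ count_ge v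

theorem add_pow_le_pow_mul_exp {x y : ℝ} (hx : 0 < x) (hy : 0 ≤ y) (m : ℕ) :
    (x + y) ^ m ≤ x ^ m * Real.exp (m * (y / x)) :=
  calc (x + y) ^ m = x ^ m * (y / x + 1) ^ m := by rw [← mul_pow]; field_simp; ring
    _ ≤ x ^ m * Real.exp (y / x) ^ m := by gcongr; exact Real.add_one_le_exp _
    _ = x ^ m * Real.exp (m * (y / x)) := by rw [Real.exp_nat_mul]

theorem sum_walkWeight_closedPath_le (hR : 1 ≤ R) (hN : 0 < N) (hm : 4 * R * (m / √N) ≤ 1 / 2) :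
    ∑ p : ClosedPath N (2 * m), walkWeight R p.1 ≤
      N ^ m * (N * catalan m *
        (Real.exp (32 * R ^ 2 * (m / √N) ^ 2) / (1 - 4 * R * (m / √N)) ^ 2)) := by
  have sqrt_pos : 0 < √(N : ℝ) := Real.sqrt_pos.mpr (Nat.cast_pos.mpr hN)
  set z : ℝ := √(N + 4 * R ^ 2 * (3 * (2 * m : ℕ) + 2))
  have sqrt_le : √N ≤ z := Real.sqrt_le_sqrt (le_add_of_nonneg_right (by positivity))
  have sq_z : z ^ 2 = N + 4 * R ^ 2 * (3 * (2 * m : ℕ) + 2) := Real.sq_sqrt (by positivity)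
  have loss : (2 * m : ℕ) * (2 * R / √N) = 4 * R * (m / √N) := by push_cast; ring
  have pow_z_le : z ^ (2 * m) ≤ N ^ m * Real.exp (32 * R ^ 2 * (m / √N) ^ 2) := by
    have self_le_sq : (m : ℝ) ≤ m ^ 2 := mod_cast Nat.le_self_pow two_ne_zero m
    rw [pow_mul, sq_z, div_pow, Real.sq_sqrt N.cast_nonneg]
    refine (add_pow_le_pow_mul_exp (Nat.cast_pos.mpr hN) (by positivity) m).trans ?_
    gcongr _ * Real.exp ?_
    calc m * (4 * R ^ 2 * (3 * (2 * m : ℕ) + 2) / N)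
        = 4 * R ^ 2 * (6 * m ^ 2 + 2 * m) / N := by push_cast; ring
      _ ≤ 4 * R ^ 2 * (6 * m ^ 2 + 2 * m ^ 2) / N := by gcongr
      _ = _ := by ring
  calc ∑ p : ClosedPath N (2 * m), walkWeight R p.1
      ≤ ∑ p : Fin (2 * m + 1) → Fin N, walkWeight R p := by
        rw [← Finset.sum_subtype {p : Fin (2 * m + 1) → Fin N | p (Fin.last _) = p 0} (by simp)]
        exact Finset.sum_le_univ_sum_of_nonneg fun p ↦ walkWeight_nonneg (by linarith) p
    _ ≤ N * (z ^ (2 * m) * catalan m / (1 - 4 * R * (m / √N)) ^ 2) := by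
        rw [← loss] at hm ⊢
        simpa using sum_walkWeight_le (V := Fin N) hR (sqrt_pos.trans_le sqrt_le) hm
          (by rw [div_mul_eq_mul_div, le_div_iff₀ sqrt_pos]; gcongr) (by simp [sq_z])
    _ ≤ N * (N ^ m * Real.exp (32 * R ^ 2 * (m / √N) ^ 2) * catalan m /
          (1 - 4 * R * (m / √N)) ^ 2) := by gcongr
    _ = _ := by ring

variable [IsProbabilityMeasure μ]

namespace IsSymmetricIID

theorem abs_integral_entryProd_le (ha : IsSymmetricIID P μ a) (mean : ∫ x, x ∂μ = 0)
    (hσ : ∫ x, x ^ 2 ∂μ = σ ^ 2) (hR : ∀ᵐ x ∂μ, |x| ≤ R * |σ|) (p : ClosedPath N n) :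
    |∫ ω, p.entryProd (randomMatrix a ω) ∂P| ≤ (|σ| / √N) ^ n * walkWeight R p.1 := by
  rw [ha.integral_entryProd, abs_mul, abs_of_nonneg (by positivity), div_eq_mul_one_div |σ|,
    mul_comm |σ|, mul_pow, mul_assoc, Finset.abs_prod]
  gcongr
  rw [walkWeight]
  split_ifs with h
  · calc ∏ e, |∫ x, x ^ passages p.1 e ∂μ|
        ≤ ∏ e, (|σ| ^ passages p.1 e * R ^ (passages p.1 e - 2)) :=
          Finset.prod_le_prod (fun _ _ ↦ abs_nonneg _) fun e _ ↦ abs_moment_le hσ hR (h e)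
      _ = |σ| ^ n * R ^ walkExcess p.1 := by
          rw [Finset.prod_mul_distrib, Finset.prod_pow_eq_pow_sum, Finset.prod_pow_eq_pow_sum,
            sum_passages, walkExcess]
  · push Not at h
    obtain ⟨e, he⟩ := h
    rw [mul_zero, Finset.prod_eq_zero (Finset.mem_univ e)]
    simp [he, mean]

theorem le_integral_entryProd (ha : IsSymmetricIID P μ a) (hσ : ∫ x, x ^ 2 ∂μ = σ ^ 2)
    (hM : ∀ᵐ x ∂μ, |x| ≤ M) {p : ClosedPath N n} (hp : p.IsEven) :
    (|σ| / √N) ^ n ≤ ∫ ω, p.entryProd (randomMatrix a ω) ∂P := by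
  rw [ha.integral_entryProd, div_eq_mul_one_div, mul_comm, mul_pow]
  gcongr
  calc |σ| ^ n = ∏ e, |σ| ^ passages p.1 e := by rw [Finset.prod_pow_eq_pow_sum, sum_passages]
    _ ≤ _ := Finset.prod_le_prod (fun _ _ ↦ by positivity) fun e _ ↦ pow_le_moment hσ hM (hp e)

theorem le_evenContribution (ha : IsSymmetricIID P μ a) (hσ : ∫ x, x ^ 2 ∂μ = σ ^ 2)
    (hM : ∀ᵐ x ∂μ, |x| ≤ M) (h : 2 * m + 1 < N) :
    N * catalan m * σ ^ (2 * m) * (1 - 3 * (m / √N) ^ 2) ≤ evenContribution P a (2 * m) := by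
  classical
  have hN : (0 : ℝ) < N := Nat.cast_pos.mpr (by omega)
  have bernoulli : 1 - 3 * (m / √N) ^ 2 ≤ (1 - (2 * m + 1 : ℕ) / N : ℝ) ^ m := by
    have self_le_sq : (m : ℝ) ≤ m ^ 2 := mod_cast Nat.le_self_pow two_ne_zero m
    have ratio_le_one : ((2 * m + 1 : ℕ) / N : ℝ) ≤ 1 :=
      (div_le_one hN).mpr (Nat.cast_le.mpr h.le)
    calc 1 - 3 * (m / √N) ^ 2 = 1 - (2 * m ^ 2 + m ^ 2) / N := by
          rw [div_pow, Real.sq_sqrt hN.le]; ring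
      _ ≤ (1 - (2 * m ^ 2 + m) / N : ℝ) := by gcongr
      _ = (1 + m * -((2 * m + 1 : ℕ) / N) : ℝ) := by push_cast; ring
      _ ≤ _ := one_add_mul_le_pow (by linarith) m
  calc N * catalan m * σ ^ (2 * m) * (1 - 3 * (m / √N) ^ 2)
      ≤ N * catalan m * σ ^ (2 * m) * (1 - (2 * m + 1 : ℕ) / N) ^ m := by
        have := (even_two_mul m).pow_nonneg σ
        gcongr
    _ = N * (catalan m * (N - (2 * m + 1 : ℕ) : ℝ) ^ m) * (|σ| / √N) ^ (2 * m) := by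
        rw [one_sub_div hN.ne', div_pow, pow_mul (|σ| / _), div_pow |σ|, sq_abs,
          Real.sq_sqrt hN.le, div_pow, pow_mul]
        ring
    _ ≤ #{p : ClosedPath N (2 * m) | p.IsEven} * (|σ| / √N) ^ (2 * m) := by
        gcongr
        exact catalan_mul_pow_le_card_even_closedPath h
    _ ≤ evenContribution P a (2 * m) := by
        rw [← nsmul_eq_mul]
        exact Finset.card_nsmul_le_sum _ _ _ fun p hp ↦
          ha.le_integral_entryProd hσ hM (Finset.mem_filter.mp hp).2

theorem evenContribution_add_abs_oddContribution_le (ha : IsSymmetricIID P μ a)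
    (mean : ∫ x, x ∂μ = 0) (hσ : ∫ x, x ^ 2 ∂μ = σ ^ 2) (hR : 1 ≤ R)
    (hRσ : ∀ᵐ x ∂μ, |x| ≤ R * |σ|) (hN : 0 < N) (hm : 4 * R * (m / √N) ≤ 1 / 2) :
    evenContribution P a (2 * m) + |oddContribution P a (2 * m)| ≤
      N * catalan m * σ ^ (2 * m) *
        (Real.exp (32 * R ^ 2 * (m / √N) ^ 2) / (1 - 4 * R * (m / √N)) ^ 2) := by
  set F := Real.exp (32 * R ^ 2 * (m / √N) ^ 2) / (1 - 4 * R * (m / √N)) ^ 2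
  calc evenContribution P a (2 * m) + |oddContribution P a (2 * m)|
      ≤ ∑ p : ClosedPath N (2 * m), |∫ ω, p.entryProd (randomMatrix a ω) ∂P| := by
        rw [← sum_even_add_sum_odd]
        exact add_le_add (Finset.sum_le_sum fun _ _ ↦ le_abs_self _)
          (Finset.abs_sum_le_sum_abs _ _)
    _ ≤ (|σ| / √N) ^ (2 * m) * ∑ p : ClosedPath N (2 * m), walkWeight R p.1 := by
        rw [Finset.mul_sum]
        exact Finset.sum_le_sum fun p _ ↦ ha.abs_integral_entryProd_le mean hσ hRσ p
    _ ≤ (|σ| / √N) ^ (2 * m) * (N ^ m * (N * catalan m * F)) := by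
        gcongr
        exact sum_walkWeight_closedPath_le hR hN hm
    _ = N * catalan m * σ ^ (2 * m) * F := by
        rw [pow_mul (|σ| / _), div_pow |σ|, sq_abs, Real.sq_sqrt N.cast_nonneg, div_pow, pow_mul]
        field_simp

end IsSymmetricIID

end Bounds

section Asymptotics

theorem isEquivalent_and_isLittleO_of_bounds {α : Type*} {l : Filter α} {u v T lo hi : α → ℝ}
    (hT : ∀ x, 0 ≤ T x) (hlo : Tendsto lo l (nhds 1)) (hhi : Tendsto hi l (nhds 1))
    (lower : ∀ᶠ x in l, T x * lo x ≤ u x) (upper : ∀ᶠ x in l, u x + |v x| ≤ T x * hi x) :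
    u ~[l] T ∧ v =o[l] T := by
  set ε : α → ℝ := fun x ↦ |lo x - 1| + |hi x - 1|
  have tendsto_ε : Tendsto ε l (nhds 0) := by
    simpa using ((hlo.sub_const 1).abs).add ((hhi.sub_const 1).abs)
  have isLittleO_εT : (fun x ↦ ε x * T x) =o[l] T := by
    simpa using ((isLittleO_one_iff ℝ).mpr tendsto_ε).mul_isBigO (isBigO_refl T l)
  have one_sub_le (x : α) : (1 - ε x) * T x ≤ T x * lo x := by
    rw [mul_comm]
    exact mul_le_mul_of_nonneg_left (by grind) (hT x)
  have le_one_add (x : α) : T x * hi x ≤ (1 + ε x) * T x := by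
    rw [mul_comm]
    exact mul_le_mul_of_nonneg_right (by grind) (hT x)
  have le_gap (x : α) : T x * hi x - T x * lo x ≤ ε x * T x := by
    rw [← mul_sub, mul_comm]
    exact mul_le_mul_of_nonneg_right (by grind) (hT x)
  constructor
  · refine (IsBigO.of_bound' ?_).trans_isLittleO isLittleO_εT
    filter_upwards [lower, upper] with x hl hu
    refine (abs_le.mpr ⟨?_, ?_⟩).trans (le_abs_self _) <;>
      linarith [one_sub_le x, le_one_add x, abs_nonneg (v x), Pi.sub_apply u T x]
  · refine (IsBigO.of_bound' ?_).trans_isLittleO isLittleO_εT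
    filter_upwards [lower, upper] with x hl hu
    exact le_trans (by rw [Real.norm_eq_abs]; linarith [le_gap x]) (le_abs_self _)

theorem two_mul_add_one_lt_of_three_mul_sq_lt {N m : ℕ} (hN : 1 < N)
    (h : 3 * (m / √N) ^ 2 < (1 : ℝ)) : 2 * m + 1 < N := by
  have three_sq_lt : 3 * m ^ 2 < N := by
    rw [div_pow, Real.sq_sqrt N.cast_nonneg, mul_div_assoc', div_lt_one (by positivity)] at h
    exact_mod_cast h
  obtain rfl | hm := m.eq_zero_or_pos
  · simpa using hN
  · nlinarith

variable {Ω : ℕ → Type*} [∀ N, MeasurableSpace (Ω N)] {P : ∀ N, Measure (Ω N)} {μ : Measure ℝ}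
  [IsProbabilityMeasure μ] {σ M : ℝ} {a : ∀ N, Fin N → Fin N → Ω N → ℝ} {s : ℕ → ℕ}

theorem evenContribution_isEquivalent_and_oddContribution_isLittleO
    (hM : ∀ᵐ x ∂μ, |x| ≤ M) (mean : ∫ x, x ∂μ = 0) (hσ : ∫ x, x ^ 2 ∂μ = σ ^ 2)
    (ha : ∀ N, IsSymmetricIID (P N) μ (a N))
    (hsN : (fun N ↦ (s N : ℝ)) =o[atTop] (fun N ↦ √(N : ℝ))) :
    (fun N ↦ evenContribution (P N) (a N) (2 * s N)) ~[atTop]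
        (fun N ↦ (N : ℝ) * catalan (s N) * σ ^ (2 * s N)) ∧
      (fun N ↦ oddContribution (P N) (a N) (2 * s N)) =o[atTop]
        (fun N ↦ (N : ℝ) * catalan (s N) * σ ^ (2 * s N)) := by
  obtain ⟨R, hR, hRσ⟩ := exists_ae_abs_le_mul_abs hM hσ
  have ratio_tendsto : Tendsto (fun N ↦ (s N : ℝ) / √N) atTop (nhds 0) :=
    hsN.tendsto_div_nhds_zero
  have three_mul_sq_tendsto : Tendsto (fun N ↦ 3 * ((s N : ℝ) / √N) ^ 2) atTop (nhds 0) := by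
    simpa using (ratio_tendsto.pow 2).const_mul 3
  have four_mul_tendsto : Tendsto (fun N ↦ 4 * R * ((s N : ℝ) / √N)) atTop (nhds 0) := by
    simpa using ratio_tendsto.const_mul (4 * R)
  have exp_tendsto :
      Tendsto (fun N ↦ Real.exp (32 * R ^ 2 * ((s N : ℝ) / √N) ^ 2)) atTop (nhds 1) := by
    simpa using ((ratio_tendsto.pow 2).const_mul (32 * R ^ 2)).rexp
  refine isEquivalent_and_isLittleO_of_bounds (lo := fun N ↦ 1 - 3 * (s N / √N) ^ 2)
    (hi := fun N ↦ Real.exp (32 * R ^ 2 * (s N / √N) ^ 2) / (1 - 4 * R * (s N / √N)) ^ 2)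
    (fun N ↦ ?_) ?_ ?_ ?_ ?_
  · have := (even_two_mul (s N)).pow_nonneg σ
    positivity
  · simpa using three_mul_sq_tendsto.const_sub 1
  · simpa [Pi.div_def] using exp_tendsto.div ((four_mul_tendsto.const_sub 1).pow 2) (by simp)
  · filter_upwards [eventually_gt_atTop 1, three_mul_sq_tendsto.eventually_lt_const one_pos]
      with N hN h
    exact (ha N).le_evenContribution hσ hM (two_mul_add_one_lt_of_three_mul_sq_lt hN h)
  · filter_upwards [eventually_gt_atTop 0, four_mul_tendsto.eventually_le_const (half_pos one_pos)]
      with N hN h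
    exact (ha N).evenContribution_add_abs_oddContribution_le mean hσ hR hRσ hN h

end Asymptotics

end WignerTrace

open WignerTrace in
theorem proposition3p1_general {Ω : ℕ → Type*} [∀ N, MeasurableSpace (Ω N)]
    {P : ∀ N, Measure (Ω N)} {μ : Measure ℝ} [IsProbabilityMeasure μ] {σ M : ℝ}
    (hM : ∀ᵐ x ∂μ, |x| ≤ M) (mean : ∫ x, x ∂μ = 0) (hσ : ∫ x, x ^ 2 ∂μ = σ ^ 2)
    {a : ∀ N, Fin N → Fin N → Ω N → ℝ} (ha : ∀ N, IsSymmetricIID (P N) μ (a N))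
    {s : ℕ → ℕ} (hsN : (fun N ↦ (s N : ℝ)) =o[atTop] (fun N ↦ √(N : ℝ))) :
    (∀ N n, Integrable (fun ω ↦ (randomMatrix (a N) ω ^ n).trace) (P N)) ∧
    (∀ N n (p : ClosedPath N n), Integrable (fun ω ↦ p.entryProd (randomMatrix (a N) ω)) (P N)) ∧
    (fun N ↦ expectedTrace (P N) (a N) (2 * s N)) ~[atTop]
      (fun N ↦ evenContribution (P N) (a N) (2 * s N)) ∧
    (fun N ↦ evenContribution (P N) (a N) (2 * s N)) ~[atTop]
      (fun N ↦ (N : ℝ) * catalan (s N) * σ ^ (2 * s N)) ∧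
    (fun N ↦ expectedTrace (P N) (a N) (2 * s N)) ~[atTop]
      (fun N ↦ (N : ℝ) * catalan (s N) * σ ^ (2 * s N)) ∧
    (fun N ↦ oddContribution (P N) (a N) (2 * s N)) =o[atTop]
      (fun N ↦ evenContribution (P N) (a N) (2 * s N)) := by
  have integrable_entryProd (N n) (p : ClosedPath N n) := (ha N).integrable_entryProd hM p
  obtain ⟨even_equiv, odd_isLittleO⟩ :=
    evenContribution_isEquivalent_and_oddContribution_isLittleO hM mean hσ ha hsN
  have odd_isLittleO_even := odd_isLittleO.trans_isBigO even_equiv.isBigO_symm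
  have trace_equiv := IsEquivalent.refl.add_isLittleO odd_isLittleO_even
  simp only [← evenContribution_add_oddContribution (integrable_entryProd _ _)]
  refine ⟨fun N n ↦ ?_, integrable_entryProd, trace_equiv, even_equiv,
    trace_equiv.trans even_equiv, odd_isLittleO_even⟩
  simp only [trace_pow_eq_sum_entryProd]
  exact integrable_finsetSum _ fun p _ ↦ integrable_entryProd N n p

theorem proposition3p1 {Ω : ℕ → Type*} [∀ N, MeasurableSpace (Ω N)]
    (P : ∀ N, Measure (Ω N)) [∀ N, IsProbabilityMeasure (P N)]
    (μ : Measure ℝ) [IsProbabilityMeasure μ] (σ : ℝ) (hμ : WignerTrace.IsEntryLaw μ σ)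
    (a : ∀ N, Fin N → Fin N → Ω N → ℝ)
    (ha : ∀ N, WignerTrace.IsSymmetricIID (P N) μ (a N))
    (s : ℕ → ℕ) (hs : Tendsto s atTop atTop)
    (hsN : (fun N => (s N : ℝ)) =o[atTop] (fun N => Real.sqrt (N : ℝ))) :
    -- all the expectations below are those of integrable variables
    (∀ N n, Integrable (fun ω => (WignerTrace.randomMatrix (a N) ω ^ n).trace) (P N)) ∧
    (∀ N n (p : WignerTrace.ClosedPath N n),
      Integrable (fun ω => p.entryProd (WignerTrace.randomMatrix (a N) ω)) (P N)) ∧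
    (fun N => WignerTrace.expectedTrace (P N) (a N) (2 * s N)) ~[atTop]
      (fun N => WignerTrace.evenContribution (P N) (a N) (2 * s N)) ∧
    (fun N => WignerTrace.evenContribution (P N) (a N) (2 * s N)) ~[atTop]
      (fun N => (N : ℝ) * (catalan (s N) : ℝ) * σ ^ (2 * s N)) ∧
    (fun N => WignerTrace.expectedTrace (P N) (a N) (2 * s N)) ~[atTop]
      (fun N => (N : ℝ) * (catalan (s N) : ℝ) * σ ^ (2 * s N)) ∧
    (fun N => WignerTrace.oddContribution (P N) (a N) (2 * s N)) =o[atTop]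
      (fun N => WignerTrace.evenContribution (P N) (a N) (2 * s N)) := by
  obtain ⟨M, hM⟩ := hμ.exists_ae_abs_le
  exact proposition3p1_general hM hμ.mean hμ.variance ha hsN
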